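/- Let $k$ be a field, $H$ a finite-dimensional Hopf algebra over $k$ with counit $\epsilon$, and $\Lambda\in H$ a left integral, i.e. $\Lambda\neq 0$ and $h\Lambda=\epsilon(h)\Lambda$ for all $h\in H$. Let $A$ be a left $H$-comodule algebra with coaction $\Delta_A:A\to H\otimes A$. For an $H$-module $V$ and an $A$-module $M$ the tensor product $V\otimes M=V\otimes_k M$ is an $A$-module via $\Delta_A$ (for $A=H$ it is the usual tensor product of $H$-modules). Let $H$-$\underline{\mathrm{mod}}$ be the quotient of the category of left $H$-modules by the morphisms that factor through an injective module, and let $A_H$-$\underline{\mathrm{mod}}$ be the quotient of the category of left $A$-modules by the morphisms that factor through a module $H\otimes N$, $N$ an $A$-module. In both, the shift is $TM=(H/k\Lambda)\otimes M$; the cone $C_u$ of a module map $u:X\to Y$ is the pushout of $u$ and $\Lambda\otimes\mathrm{id}:X\to H\otimes X$, which gives a standard triangle $X\to Y\to C_u\to TX$; and the distinguished triangles are the sextuples $X\to Y\to Z\to TX$ isomorphic in the quotient category to a standard triangle. The Grothendieck group has generators $[X]$ and relations $[Y]=[X]+[Z]$ for the distinguished triangles $X\to Y\to Z\to TX$. $K(H\text{-}\underline{\mathrm{mod}})$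 is formed with finite-dimensional $H$-modules, and $K(A_H\text{-}\underline{\mathrm{mod}})$ with the $A$-modules of an arbitrary fixed class $\mathcal P$ that is closed under finite direct sums, submodules and quotient modules, and $M\mapsto H\otimes M$. Then: 1. There are isomorphisms of $H$-modules $r_V:V\otimes H\to H\otimes V$, functorial in the $H$-module $V$, with $r_V\circ(\mathrm{id}\otimes\Lambda)=\Lambda\otimes\mathrm{id}$ as maps $V\to H\otimes V$. 2. For every $H$-module $V$, tensoring with $V$ descends to an exact functor on $A_H$-$\underline{\mathrm{mod}}$: the functor $V\otimes(-)$ on $A$-modules induces an additive functor on $A_H$-$\underline{\mathrm{mod}}$, and there is a natural isomorphism $\theta_X:V\otimes TX\to T(V\otimes X)$ such that for every distinguished triangle $X\xrightarrow{p}Y\xrightarrow{q}Z\xrightarrow{r}TX$ the sextuple $V\otimes X\xrightarrow{V\otimes p}V\otimes Y\xrightarrow{V\otimes q}V\otimes Z\xrightarrow{\theta_X\circ(V\otimes r)}T(V\otimes X)$ is a distinguished triangle. 3. The abelian group $K(H\text{-}\underline{\mathrm{mod}})$ is a ring with $[V][W]=[V\otimes W]$ and unit $[k]$ ($k$ the trivial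 module given by $\epsilon$), and for every class $\mathcal P$ as above $K(A_H\text{-}\underline{\mathrm{mod}})$ is a left module over this ring, with $V\otimes M\in\mathcal P$ and $[V]\cdot[M]=[V\otimes M]$ for every finite-dimensional $H$-module $V$ and every $M\in\mathcal P$. -/

import Mathlib

open CategoryTheory

universe u

namespace Hopfological

open scoped TensorProduct ModuleCat

noncomputable section

/-! ### Comodule algebras and the action of `H`-modules on `A`-modules -/

/-- A left `H`-comodule algebra over `k`: a `k`-algebra `A` with a `k`-algebra map
`Δ_A : A → H ⊗ A` such that `(ε ⊗ id) Δ_A = id` and `(Δ ⊗ id) Δ_A = (id ⊗ Δ_A) Δ_A`. -/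
class LeftComoduleAlgebra (k H A : Type u) [Field k] [Ring H] [HopfAlgebra k H]
    [Ring A] [Algebra k A] where
  /-- The coaction. -/
  coact : A →ₐ[k] H ⊗[k] A
  counit_coact : ∀ a : A,
    TensorProduct.lid k A ((Coalgebra.counit (R := k) (A := H)).rTensor A (coact a)) = a
  coassoc : ∀ a : A,
    TensorProduct.assoc k H H A ((Coalgebra.comul (R := k) (A := H)).rTensor A (coact a)) =
      coact.toLinearMap.lTensor H (coact a)

/-- `H` is a left comodule algebra over itself through its comultiplication. -/
instance LeftComoduleAlgebra.self (k H : Type u) [Field k] [Ring H] [HopfAlgebra k H] :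
    LeftComoduleAlgebra k H H where
  coact := Bialgebra.comulAlgHom k H
  counit_coact a := by simp
  coassoc a := by simp

section Tensor

variable (k : Type u) {H : Type u} {A : Type u} [Field k] [Ring H] [HopfAlgebra k H]
  [Ring A] [Algebra k A] [LeftComoduleAlgebra k H A]

/-- For `t = ∑ hᵢ ⊗ aᵢ` in `H ⊗ A`, the endomorphism `v ⊗ m ↦ ∑ hᵢ v ⊗ aᵢ m` of `V ⊗ M`. -/
def tensorActionAux (V : ModuleCat.{u} H) (M : ModuleCat.{u} A) :
    H ⊗[k] A →ₐ[k] Module.End k (V ⊗[k] M) :=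
  Module.endTensorEndAlgHom.comp
    (Algebra.TensorProduct.map (Algebra.lsmul k k (V : Type u)) (Algebra.lsmul k k (M : Type u)))

/-- The algebra map `A → H ⊗ A → End (V ⊗ M)`, for an `H`-module `V` and an `A`-module `M`. -/
def tensorAction (V : ModuleCat.{u} H) (M : ModuleCat.{u} A) :
    A →ₐ[k] Module.End k (V ⊗[k] M) :=
  (tensorActionAux k V M).comp (LeftComoduleAlgebra.coact (k := k) (H := H) (A := A))

/-- The `A`-module `V ⊗ M` (the tensor product is over `k`), on which `A` acts through `Δ_A`. For
`A = H` this is the tensor product of `H`-modules, with `H` acting through `Δ`. -/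
def tensorObj (V : ModuleCat.{u} H) (M : ModuleCat.{u} A) : ModuleCat.{u} A :=
  letI : Module A (V ⊗[k] M) := Module.compHom (V ⊗[k] M) (tensorAction k V M).toRingHom
  ModuleCat.of A (V ⊗[k] M)

variable {k} in
/-- The pure tensor `v ⊗ m`, as an element of the `A`-module `V ⊗ M`. -/
def tmul {V : ModuleCat.{u} H} {M : ModuleCat.{u} A} (v : V) (m : M) : tensorObj k V M :=
  (v ⊗ₜ[k] m : V ⊗[k] M)

theorem tensorObj_smul (V : ModuleCat.{u} H) (M : ModuleCat.{u} A) (a : A)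
    (x : tensorObj k V M) :
    a • x = tensorActionAux k V M (LeftComoduleAlgebra.coact (k := k) (H := H) a) x := rfl

variable {k} in
/-- If `Δ_A(a) = ∑ hᵢ ⊗ aᵢ` then `a (v ⊗ m) = ∑ hᵢ v ⊗ aᵢ m`. -/
theorem tensorObj_smul_tmul {V : ModuleCat.{u} H} {M : ModuleCat.{u} A} (a : A)
    {ι : Type*} (s : Finset ι) (h : ι → H) (b : ι → A)
    (hs : LeftComoduleAlgebra.coact (k := k) (H := H) a = ∑ i ∈ s, h i ⊗ₜ[k] b i)
    (v : V) (m : M) :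
    a • (tmul v m : tensorObj k V M) = ∑ i ∈ s, (tmul (h i • v) (b i • m) : tensorObj k V M) := by
  rw [tensorObj_smul, hs, map_sum]
  change (∑ i ∈ s, tensorActionAux k V M (h i ⊗ₜ[k] b i)) (v ⊗ₜ[k] m : V ⊗[k] M) = _
  rw [LinearMap.sum_apply]
  rfl

theorem tmul_add {V : ModuleCat.{u} H} {M : ModuleCat.{u} A} (v : V) (m m' : M) :
    (tmul v (m + m') : tensorObj k V M) = tmul v m + tmul v m' :=
  TensorProduct.tmul_add v m m'

theorem add_tmul {V : ModuleCat.{u} H} {M : ModuleCat.{u} A} (v v' : V) (m : M) :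
    (tmul (v + v') m : tensorObj k V M) = tmul v m + tmul v' m :=
  TensorProduct.add_tmul v v' m

theorem tmul_sum {V : ModuleCat.{u} H} {M : ModuleCat.{u} A} {ι : Type*} (s : Finset ι) (v : V)
    (m : ι → M) : (tmul v (∑ i ∈ s, m i) : tensorObj k V M) = ∑ i ∈ s, tmul v (m i) :=
  TensorProduct.tmul_sum v s m

theorem sum_tmul {V : ModuleCat.{u} H} {M : ModuleCat.{u} A} {ι : Type*} (s : Finset ι) (v : ι → V)
    (m : M) : (tmul (∑ i ∈ s, v i) m : tensorObj k V M) = ∑ i ∈ s, tmul (v i) m :=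
  TensorProduct.sum_tmul s v m

theorem zero_tmul {V : ModuleCat.{u} H} {M : ModuleCat.{u} A} (m : M) :
    (tmul (0 : V) m : tensorObj k V M) = 0 :=
  TensorProduct.zero_tmul _ m

theorem smul_tmul {V : ModuleCat.{u} H} {M : ModuleCat.{u} A} (c : k) (v : V) (m : M) :
    (tmul (algebraMap k H c • v) m : tensorObj k V M) = tmul v (algebraMap k A c • m) :=
  TensorProduct.smul_tmul c v m

/-- The `k`-linear map underlying a morphism of `A`-modules. -/
def kLin {A : Type u} [Ring A] [Algebra k A] {M N : ModuleCat.{u} A} (f : M ⟶ N) : M →ₗ[k] N :=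
  f.hom.restrictScalars k

theorem map_tensorActionAux {V V' : ModuleCat.{u} H} {M M' : ModuleCat.{u} A} (f : V ⟶ V')
    (g : M ⟶ M') (t : H ⊗[k] A) :
    TensorProduct.map (kLin k f) (kLin k g) ∘ₗ tensorActionAux k V M t =
      tensorActionAux k V' M' t ∘ₗ TensorProduct.map (kLin k f) (kLin k g) := by
  induction t using TensorProduct.induction_on with
  | zero => simp
  | add s t hs ht => rw [map_add, map_add, LinearMap.comp_add, LinearMap.add_comp, hs, ht]
  | tmul h b =>
    refine TensorProduct.ext' fun v m => ?_
    change f.hom (h • v) ⊗ₜ[k] g.hom (b • m) = (h • f.hom v) ⊗ₜ[k] (b • g.hom m)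
    rw [map_smul, map_smul]

/-- `f ⊗ g : V ⊗ M → V' ⊗ M'`. -/
def tensorHom {V V' : ModuleCat.{u} H} {M M' : ModuleCat.{u} A} (f : V ⟶ V') (g : M ⟶ M') :
    tensorObj k V M ⟶ tensorObj k V' M' :=
  ModuleCat.ofHom (R := A) (X := tensorObj k V M) (Y := tensorObj k V' M')
    { toFun := fun x => (TensorProduct.map (kLin k f) (kLin k g) (x : V ⊗[k] M) : V' ⊗[k] M')
      map_add' := fun x y => map_add (TensorProduct.map (kLin k f) (kLin k g)) x y
      map_smul' := fun a x =>
        LinearMap.congr_fun (map_tensorActionAux k f g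
          (LeftComoduleAlgebra.coact (k := k) (H := H) a)) x }

variable {k} in
theorem tensorHom_tmul {V V' : ModuleCat.{u} H} {M M' : ModuleCat.{u} A} (f : V ⟶ V')
    (g : M ⟶ M') (v : V) (m : M) :
    (tensorHom k f g).hom (tmul v m) = tmul (f.hom v) (g.hom m) := rfl

variable {k} in
/-- Two morphisms out of `V ⊗ M` that agree on pure tensors are equal. -/
theorem tensor_ext {V : ModuleCat.{u} H} {M N : ModuleCat.{u} A} {f g : tensorObj k V M ⟶ N}
    (h : ∀ (v : V) (m : M), f.hom (tmul v m) = g.hom (tmul v m)) : f = g := by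
  ext x
  refine TensorProduct.induction_on (motive := fun x : V ⊗[k] M => f.hom x = g.hom x) x ?_ h ?_
  · exact (map_zero f.hom).trans (map_zero g.hom).symm
  · intro x y hx hy
    exact (map_add f.hom _ _).trans ((congrArg₂ _ hx hy).trans (map_add g.hom _ _).symm)

/-- The endofunctor `M ↦ V ⊗ M` of `A`-modules. -/
def tensorFunctor (V : ModuleCat.{u} H) : ModuleCat.{u} A ⥤ ModuleCat.{u} A where
  obj M := tensorObj k V M
  map g := tensorHom k (𝟙 V) g
  map_id _ := tensor_ext fun _ _ => rfl
  map_comp _ _ := tensor_ext fun _ _ => rfl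

instance (V : ModuleCat.{u} H) : (tensorFunctor k V : ModuleCat.{u} A ⥤ ModuleCat.{u} A).Additive where
  map_add {_ _ f g} := tensor_ext fun v m => tmul_add k v (f.hom m) (g.hom m)

end Tensor

/-! ### Integrals, the shift and cones -/

section Integral

variable (k : Type u) {H : Type u} [Field k] [Ring H] [HopfAlgebra k H]

/-- `Λ` is a left integral of `H`: a nonzero element with `h Λ = ε(h) Λ` for all `h`. -/
structure IsLeftIntegral (Λ : H) : Prop where
  ne_zero : Λ ≠ 0
  mul_eq : ∀ h : H, h * Λ = Coalgebra.counit (R := k) h • Λ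

/-- The regular left `H`-module. -/
abbrev regular (H : Type u) [Ring H] : ModuleCat.{u} H := ModuleCat.of H H

/-- The one-dimensional `H`-module `k`, on which `H` acts through the counit. -/
def trivialModule (H : Type u) [Ring H] [HopfAlgebra k H] : ModuleCat.{u} H :=
  letI : Module H k := Module.compHom k (Bialgebra.counitAlgHom k H).toRingHom
  ModuleCat.of H k

/-- The `H`-module `H / kΛ`; for a left integral `Λ` the left ideal `HΛ` equals `kΛ`. -/
abbrev regularModIntegral (Λ : H) : ModuleCat.{u} H :=
  ModuleCat.of H (H ⧸ Submodule.span H {Λ})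

/-- The quotient map `H → H / kΛ`. -/
abbrev regularProj (Λ : H) : regular H ⟶ regularModIntegral Λ :=
  ModuleCat.ofHom (Submodule.span H {Λ}).mkQ

variable {A : Type u} [Ring A] [Algebra k A] [LeftComoduleAlgebra k H A]

/-- The inclusion of `A`-modules `Λ ⊗ id : M → H ⊗ M`. -/
def integralInclusion {Λ : H} (hΛ : IsLeftIntegral k Λ) (M : ModuleCat.{u} A) :
    M ⟶ tensorObj k (regular H) M :=
  ModuleCat.ofHom (R := A) (X := M) (Y := tensorObj k (regular H) M)
    { toFun := fun m => tmul (V := regular H) Λ m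
      map_add' := fun m m' => tmul_add k (V := regular H) Λ m m'
      map_smul' := fun a m => by
        obtain ⟨s, hs⟩ := TensorProduct.exists_finset
          (LeftComoduleAlgebra.coact (k := k) (H := H) a)
        have h1 := LeftComoduleAlgebra.counit_coact (k := k) (H := H) a
        rw [hs] at h1
        simp only [map_sum, LinearMap.rTensor_tmul, TensorProduct.lid_tmul] at h1
        rw [RingHom.id_apply, tensorObj_smul_tmul a s Prod.fst Prod.snd hs]
        conv_lhs => rw [← h1, Finset.sum_smul, tmul_sum]
        refine Finset.sum_congr rfl fun i _ => ?_
        rw [Algebra.smul_def, mul_smul, ← smul_tmul]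
        refine congrArg (fun z : H => tmul (V := regular H) z (i.2 • m)) ?_
        rw [smul_eq_mul, smul_eq_mul, hΛ.mul_eq i.1, Algebra.smul_def] }

/-- The inclusion of `H`-modules `id ⊗ Λ : V → V ⊗ H`. -/
def integralInclusionRight {Λ : H} (hΛ : IsLeftIntegral k Λ) (V : ModuleCat.{u} H) :
    V ⟶ tensorObj k V (regular H) :=
  ModuleCat.ofHom (R := H) (X := V) (Y := tensorObj k V (regular H))
    { toFun := fun v => tmul (M := regular H) v Λ
      map_add' := fun v v' => add_tmul k (M := regular H) v v' Λ
      map_smul' := fun a v => by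
        obtain ⟨s, hs⟩ := TensorProduct.exists_finset (Coalgebra.comul (R := k) a)
        have h1 := congrArg (TensorProduct.rid k H) (Coalgebra.lTensor_counit_comul (R := k) a)
        rw [hs] at h1
        simp only [map_sum, LinearMap.lTensor_tmul, TensorProduct.rid_tmul, one_smul] at h1
        rw [RingHom.id_apply, tensorObj_smul_tmul a s Prod.fst Prod.snd hs]
        conv_lhs => rw [← h1, Finset.sum_smul, sum_tmul]
        refine Finset.sum_congr rfl fun i _ => ?_
        rw [Algebra.smul_def, mul_smul, smul_tmul]
        refine congrArg (fun z : H => tmul (M := regular H) (i.1 • v) z) ?_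
        rw [smul_eq_mul, smul_eq_mul, hΛ.mul_eq i.2, Algebra.smul_def] }

/-- The shift functor `T M = (H / kΛ) ⊗ M` on `A`-modules. -/
def shift (A : Type u) [Ring A] [Algebra k A] [LeftComoduleAlgebra k H A] (Λ : H) :
    ModuleCat.{u} A ⥤ ModuleCat.{u} A :=
  tensorFunctor k (regularModIntegral Λ)

/-- The quotient map `H ⊗ M → T M`. -/
def shiftProj (Λ : H) (M : ModuleCat.{u} A) :
    tensorObj k (regular H) M ⟶ (shift k A Λ).obj M :=
  tensorHom k (regularProj Λ) (𝟙 M)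

theorem integralInclusion_shiftProj {Λ : H} (hΛ : IsLeftIntegral k Λ) (M : ModuleCat.{u} A) :
    integralInclusion k hΛ M ≫ shiftProj k Λ M = 0 := by
  ext m
  have h0 : (regularProj Λ).hom Λ = 0 :=
    (Submodule.Quotient.mk_eq_zero _).2 (Submodule.mem_span_singleton_self Λ)
  change (tmul ((regularProj Λ).hom Λ) m : tensorObj k (regularModIntegral Λ) M) = 0
  rw [h0]
  exact zero_tmul k m

/-- The cone of `f : X → Y`: the pushout of `f` and `Λ ⊗ id : X → H ⊗ X`. -/
def cone {Λ : H} (hΛ : IsLeftIntegral k Λ) {X Y : ModuleCat.{u} A} (f : X ⟶ Y) : ModuleCat.{u} A :=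
  Limits.pushout f (integralInclusion k hΛ X)

/-- The map `v : Y → C_f`. -/
def coneIn {Λ : H} (hΛ : IsLeftIntegral k Λ) {X Y : ModuleCat.{u} A} (f : X ⟶ Y) :
    Y ⟶ cone k hΛ f :=
  Limits.pushout.inl f (integralInclusion k hΛ X)

/-- The map `w : C_f → T X`, which vanishes on `Y` and is the quotient map on `H ⊗ X`. -/
def coneOut {Λ : H} (hΛ : IsLeftIntegral k Λ) {X Y : ModuleCat.{u} A} (f : X ⟶ Y) :
    cone k hΛ f ⟶ (shift k A Λ).obj X :=
  Limits.pushout.desc 0 (shiftProj k Λ X) (by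
    rw [Limits.comp_zero, integralInclusion_shiftProj])

end Integral

/-! ### Stable categories, distinguished triangles, Grothendieck groups -/

section Stable

variable {A : Type u} [Ring A]

/-- `f` factors through a module from the class `S`. -/
def FactorsThrough (S : ObjectProperty (ModuleCat.{u} A)) {M N : ModuleCat.{u} A} (f : M ⟶ N) :
    Prop :=
  ∃ P : ModuleCat.{u} A, S P ∧ ∃ (g₁ : M ⟶ P) (g₂ : P ⟶ N), g₁ ≫ g₂ = f

/-- Two morphisms are identified when their difference factors through a module from `S`. -/
def stableRel (S : ObjectProperty (ModuleCat.{u} A)) : HomRel (ModuleCat.{u} A) :=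
  fun _ _ f g => FactorsThrough S (f - g)

/-- The quotient of the category of `A`-modules by the morphisms that factor through a module
from `S`. -/
abbrev StableCat (S : ObjectProperty (ModuleCat.{u} A)) := CategoryTheory.Quotient (stableRel S)

/-- The quotient functor. -/
abbrev toStable (S : ObjectProperty (ModuleCat.{u} A)) : ModuleCat.{u} A ⥤ StableCat S :=
  CategoryTheory.Quotient.functor (stableRel S)

theorem stableRel_congruence (S : ObjectProperty (ModuleCat.{u} A))
    (h0 : ∀ M N : ModuleCat.{u} A, FactorsThrough S (0 : M ⟶ N))
    (hadd : ∀ (M N : ModuleCat.{u} A) (f g : M ⟶ N), FactorsThrough S f → FactorsThrough S g →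
      FactorsThrough S (f + g)) : Congruence (stableRel S) where
  comp_left := by
    rintro X Y Z f g g' ⟨P, hP, a, b, h⟩
    exact ⟨P, hP, f ≫ a, b, by rw [Category.assoc, h, Preadditive.comp_sub]⟩
  comp_right := by
    rintro X Y Z f f' g ⟨P, hP, a, b, h⟩
    exact ⟨P, hP, a, b ≫ g, by rw [← Category.assoc, h, Preadditive.sub_comp]⟩
  equivalence := by
    refine ⟨fun f => ?_, ?_, ?_⟩
    · change FactorsThrough S (f - f)
      rw [sub_self]; exact h0 _ _
    · rintro f g ⟨P, hP, a, b, h⟩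
      exact ⟨P, hP, a, -b, by rw [Preadditive.comp_neg, h, neg_sub]⟩
    · intro f g l h1 h2
      have := hadd _ _ _ _ h1 h2
      rwa [sub_add_sub_cancel] at this

variable (k : Type u) {H : Type u} [Field k] [Ring H] [HopfAlgebra k H] [Algebra k A]
  [LeftComoduleAlgebra k H A]

/-- The class of `A`-modules of the form `H ⊗ N`, for `A`-modules `N`. The morphisms that factor
through it are the null-homotopic ones. -/
def induced (H A : Type u) [Ring H] [HopfAlgebra k H] [Ring A] [Algebra k A]
    [LeftComoduleAlgebra k H A] : ObjectProperty (ModuleCat.{u} A) :=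
  fun P => ∃ N : ModuleCat.{u} A, Nonempty (P ≅ tensorObj k (regular H) N)

/-- The class of injective `H`-modules. -/
def injectives (H : Type u) [Ring H] : ObjectProperty (ModuleCat.{u} H) := fun P => Injective P

/-- The stable category `A_H-mod`: the quotient of `A`-modules by the null-homotopic morphisms. -/
abbrev StableA (H A : Type u) [Ring H] [HopfAlgebra k H] [Ring A] [Algebra k A]
    [LeftComoduleAlgebra k H A] := StableCat (induced k H A)

theorem induced_zero (M N : ModuleCat.{u} A) : FactorsThrough (induced k H A) (0 : M ⟶ N) :=
  ⟨tensorObj k (regular H) M, ⟨M, ⟨Iso.refl _⟩⟩, 0, 0, by simp⟩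

theorem induced_add (M N : ModuleCat.{u} A) (f g : M ⟶ N)
    (hf : FactorsThrough (induced k H A) f) (hg : FactorsThrough (induced k H A) g) :
    FactorsThrough (induced k H A) (f + g) := by
  obtain ⟨P, ⟨X, ⟨e⟩⟩, a, b, rfl⟩ := hf
  obtain ⟨P', ⟨X', ⟨e'⟩⟩, a', b', rfl⟩ := hg
  let F : ModuleCat.{u} A ⥤ ModuleCat.{u} A := tensorFunctor k (regular H)
  let i : P ≅ F.obj X := e
  let i' : P' ≅ F.obj X' := e'
  refine ⟨F.obj (X ⊞ X'), ⟨_, ⟨Iso.refl _⟩⟩,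
    a ≫ i.hom ≫ F.map Limits.biprod.inl + a' ≫ i'.hom ≫ F.map Limits.biprod.inr,
    F.map Limits.biprod.fst ≫ i.inv ≫ b + F.map Limits.biprod.snd ≫ i'.inv ≫ b', ?_⟩
  simp only [Preadditive.add_comp, Preadditive.comp_add, Category.assoc, ← F.map_comp_assoc,
    Limits.biprod.inl_fst, Limits.biprod.inl_snd, Limits.biprod.inr_fst, Limits.biprod.inr_snd,
    F.map_id, F.map_zero, Category.id_comp, Limits.zero_comp, Limits.comp_zero, add_zero, zero_add,
    Iso.hom_inv_id_assoc]

instance induced_congruence : Congruence (stableRel (induced k H A)) :=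
  stableRel_congruence _ (induced_zero k) (induced_add k)

/-- `A_H-mod` is a preadditive category, with the addition of morphisms of `A`-modules. -/
instance stablePreadditive : Preadditive (StableA k H A) :=
  CategoryTheory.Quotient.preadditive _ (by
    rintro X Y f₁ f₂ g₁ g₂ h1 h2
    have h := induced_add k _ _ _ _ h1 h2
    change FactorsThrough _ _
    rwa [add_sub_add_comm])

/-- Tensoring with `V` respects the identification of homotopic morphisms. -/
def TensorDescends (A : Type u) [Ring A] [Algebra k A] [LeftComoduleAlgebra k H A]
    (V : ModuleCat.{u} H) : Prop :=
  ∀ (M N : ModuleCat.{u} A) (f g : M ⟶ N), stableRel (induced k H A) f g →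
    (tensorFunctor k V ⋙ toStable (induced k H A)).map f =
      (tensorFunctor k V ⋙ toStable (induced k H A)).map g

/-- The functor `M ↦ V ⊗ M` on `A_H-mod`. -/
def stableTensor {V : ModuleCat.{u} H} (hV : TensorDescends k A V) :
    StableA k H A ⥤ StableA k H A :=
  CategoryTheory.Quotient.lift _ (tensorFunctor k V ⋙ toStable (induced k H A)) hV

/-- A sextuple `X → Y → Z → T X` in the stable category is a distinguished triangle if it is
isomorphic in the stable category to the standard triangle `X₀ → Y₀ → C_f → T X₀` of a morphism
`f` of modules. The isomorphism is `(a, b, c)`, given by representatives; the class of `T a` is the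
shift of the class of `a`. -/
def IsDistinguished {Λ : H} (hΛ : IsLeftIntegral k Λ) (S : ObjectProperty (ModuleCat.{u} A))
    {X Y Z : ModuleCat.{u} A}
    (p : (toStable S).obj X ⟶ (toStable S).obj Y) (q : (toStable S).obj Y ⟶ (toStable S).obj Z)
    (r : (toStable S).obj Z ⟶ (toStable S).obj ((shift k A Λ).obj X)) : Prop :=
  ∃ (X₀ Y₀ : ModuleCat.{u} A) (f : X₀ ⟶ Y₀) (a : X ⟶ X₀) (b : Y ⟶ Y₀) (c : Z ⟶ cone k hΛ f),
    IsIso ((toStable S).map a) ∧ IsIso ((toStable S).map b) ∧ IsIso ((toStable S).map c) ∧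
    p ≫ (toStable S).map b = (toStable S).map a ≫ (toStable S).map f ∧
    q ≫ (toStable S).map c = (toStable S).map b ≫ (toStable S).map (coneIn k hΛ f) ∧
    r ≫ (toStable S).map ((shift k A Λ).map a) =
      (toStable S).map c ≫ (toStable S).map (coneOut k hΛ f)

/-- The relations `[Y] = [X] + [Z]`, one for each distinguished triangle `X → Y → Z → T X` of the
stable category with vertices in the class `P`. -/
def triangleRelations {Λ : H} (hΛ : IsLeftIntegral k Λ) (S P : ObjectProperty (ModuleCat.{u} A)) :
    Set (FreeAbelianGroup P.FullSubcategory) :=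
  {t | ∃ (X Y Z : P.FullSubcategory) (p : (toStable S).obj X.obj ⟶ (toStable S).obj Y.obj)
    (q : (toStable S).obj Y.obj ⟶ (toStable S).obj Z.obj)
    (r : (toStable S).obj Z.obj ⟶ (toStable S).obj ((shift k A Λ).obj X.obj)),
    IsDistinguished k hΛ S p q r ∧
      t = FreeAbelianGroup.of Y - (FreeAbelianGroup.of X + FreeAbelianGroup.of Z)}

/-- The Grothendieck group of the stable category of modules from the class `P`. -/
def GrothendieckGroup {Λ : H} (hΛ : IsLeftIntegral k Λ) (S P : ObjectProperty (ModuleCat.{u} A)) :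
    Type (u + 1) :=
  FreeAbelianGroup P.FullSubcategory ⧸ AddSubgroup.closure (triangleRelations k hΛ S P)

instance grothendieckAddCommGroup {Λ : H} (hΛ : IsLeftIntegral k Λ)
    (S P : ObjectProperty (ModuleCat.{u} A)) : AddCommGroup (GrothendieckGroup k hΛ S P) :=
  QuotientAddGroup.Quotient.addCommGroup _

/-- The class `[M]` of a module `M` from the class `P`. -/
def cls {Λ : H} (hΛ : IsLeftIntegral k Λ) (S P : ObjectProperty (ModuleCat.{u} A))
    (M : P.FullSubcategory) : GrothendieckGroup k hΛ S P :=
  QuotientAddGroup.mk (FreeAbelianGroup.of M)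

/-- The class of `H`-modules of finite dimension over `k`. -/
def finDim (H : Type u) [Ring H] [HopfAlgebra k H] : ObjectProperty (ModuleCat.{u} H) :=
  fun V => FiniteDimensional k V

theorem finDim_trivialModule : finDim k H (trivialModule k H) := by
  change FiniteDimensional k (trivialModule k H)
  have : Function.Surjective
      (LinearMap.toSpanSingleton k (trivialModule k H) (1 : k)) := by
    intro x
    refine ⟨(x : k), ?_⟩
    have h : ∀ c : k, Bialgebra.counitAlgHom k H (algebraMap k H c) * (1 : k) = c := fun c => by
      rw [AlgHom.commutes, mul_one]; rfl
    exact h x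
  exact Module.Finite.of_surjective _ this

theorem finDim_tensorObj {V W : ModuleCat.{u} H} (hV : finDim k H V) (hW : finDim k H W) :
    finDim k H (tensorObj k V W) := by
  have : FiniteDimensional k V := hV
  have : FiniteDimensional k W := hW
  let e : V ⊗[k] W →ₗ[k] tensorObj k V W :=
    { toFun := fun x => x
      map_add' := fun _ _ => rfl
      map_smul' := fun c x => by
        change (c • x : V ⊗[k] W) = tensorAction k V W (algebraMap k H c) x
        rw [AlgHom.commutes]; rfl }
  exact Module.Finite.of_surjective e fun x => ⟨x, rfl⟩

/-- The Grothendieck group `K(H-mod)` of the stable category of finite-dimensional `H`-modules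
(modulo morphisms that factor through an injective module). -/
abbrev KH {Λ : H} (hΛ : IsLeftIntegral k Λ) : Type (u + 1) :=
  GrothendieckGroup k hΛ (injectives H) (finDim k H)

/-- The class in `K(H-mod)` of a finite-dimensional `H`-module. -/
abbrev clsH {Λ : H} (hΛ : IsLeftIntegral k Λ) (V : (finDim k H).FullSubcategory) : KH k hΛ :=
  cls k hΛ (injectives H) (finDim k H) V

/-- The Grothendieck group `K(A_H-mod)` formed with the `A`-modules from the class `P`. -/
abbrev KA {Λ : H} (hΛ : IsLeftIntegral k Λ) (P : ObjectProperty (ModuleCat.{u} A)) :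
    Type (u + 1) :=
  GrothendieckGroup k hΛ (induced k H A) P

/-- The class in `K(A_H-mod)` of an `A`-module from the class `P`. -/
abbrev clsA {Λ : H} (hΛ : IsLeftIntegral k Λ) (P : ObjectProperty (ModuleCat.{u} A))
    (M : P.FullSubcategory) : KA k hΛ P :=
  cls k hΛ (induced k H A) P M

end Stable

end

end Hopfological

open Hopfological

/-!
Both `V ⊗ H` and `H ⊗ V` are free `H`-modules on the vector space `V`, through `h ⊗ v ↦ ∑ h₁v ⊗ h₂`
and `h ⊗ v ↦ ∑ h₁ ⊗ h₂v`. In these coordinates `v ⊗ Λ` and `Λ ⊗ v` become `∑ Λ₂ ⊗ S⁻¹(Λ₁)v` and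
`∑ Λ₁ ⊗ S(Λ₂)v`. A nonzero integral makes `H` a Frobenius algebra, and the Frobenius form produces a
unit `u` with `∑ Λ₂u ⊗ S⁻¹(Λ₁) = ∑ Λ₁ ⊗ S(Λ₂)`; right multiplication by `u` is therefore an
isomorphism `V ⊗ H ≅ H ⊗ V` that matches the two embeddings of `V`.

Tensored with an `A`-module `X`, this isomorphism identifies `V ⊗ X → V ⊗ H ⊗ X` with
`V ⊗ X → H ⊗ V ⊗ X`, so `V ⊗ (-)`, which is right exact, preserves the pushout squares that define
cones, and also the modules `H ⊗ N`. For the other variable, averaging with the Casimir element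
`∑ Λ₁ ⊗ S(Λ₂)` shows that the `H`-modules `H ⊗ N` are injective. Hence the injective `H`-modules and
the modules `H ⊗ N` define the same stable category, and `(-) ⊗ M` maps triangles of `H`-modules to
triangles of `A`-modules. The product on Grothendieck groups is thereby well defined, and its
associativity and unit laws come from the associators and unitors of the tensor product.
-/

namespace Hopfological

open scoped TensorProduct ModuleCat

noncomputable section

/-! ### Convolution and the coopposite coalgebra -/

section Convolution

open Coalgebra WithConv

section Twist

variable {R C B : Type*} (V : Type*) [CommRing R] [AddCommGroup C] [Module R C] [Coalgebra R C]
  [Ring B] [Algebra R B] [AddCommGroup V] [Module R V] [Module B V] [IsScalarTower R B V]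

/-- The endomorphism `c ⊗ v ↦ ∑ c₁ ⊗ f(c₂) v` of `C ⊗ V`, for a linear map `f` from a coalgebra `C`
to an algebra acting on `V`. -/
def twist (f : C →ₗ[R] B) : Module.End R (C ⊗[R] V) :=
  (TensorProduct.lift ((Algebra.lsmul R R V).toLinearMap ∘ₗ f)).lTensor C ∘ₗ
    (TensorProduct.assoc R C C V).toLinearMap ∘ₗ comul.rTensor V

variable {V}

theorem twist_tmul (f : C →ₗ[R] B) {c : C} {ι : Type*} (r : Repr R c ι) (v : V) :
    twist V f (c ⊗ₜ[R] v) = ∑ i ∈ r.index, r.left i ⊗ₜ[R] (f (r.right i) • v) := by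
  simp [twist, ← r.eq, TensorProduct.sum_tmul]

theorem twist_one : twist V (ofConv (1 : WithConv (C →ₗ[R] B))) = 1 := by
  refine TensorProduct.ext' fun c v => ?_
  have h : ∑ i ∈ (ℛ R c).index, counit (R := R) ((ℛ R c).right i) • (ℛ R c).left i = c := by
    simpa only [map_sum, TensorProduct.rid_tmul, one_smul] using
      congrArg (TensorProduct.rid R C) (sum_tmul_counit_eq (ℛ R c))
  simp only [twist_tmul _ (ℛ R c), LinearMap.convOne_def, ofConv_toConv, LinearMap.comp_apply,
    Algebra.linearMap_apply, algebraMap_smul, ← TensorProduct.smul_tmul,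
    ← TensorProduct.sum_tmul, h, Module.End.one_apply]

theorem twist_mul (f g : WithConv (C →ₗ[R] B)) :
    twist V (ofConv (f * g)) = twist V f.ofConv * twist V g.ofConv := by
  refine TensorProduct.ext' fun c v => ?_
  let act : C ⊗[R] C →ₗ[R] V :=
    (LinearMap.toSpanSingleton B V v).restrictScalars R ∘ₗ
      LinearMap.mul' R B ∘ₗ TensorProduct.map f.ofConv g.ofConv
  have h := congrArg (act.lTensor C)
    (sum_tmul_tmul_eq (ℛ R c) (fun i => ℛ R ((ℛ R c).left i)) fun i => ℛ R ((ℛ R c).right i))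
  have hg (i) := twist_tmul f.ofConv (ℛ R ((ℛ R c).left i)) (g.ofConv ((ℛ R c).right i) • v)
  rw [Module.End.mul_apply, twist_tmul _ (ℛ R c), twist_tmul _ (ℛ R c), map_sum]
  simp only [hg, (ℛ R _).convMul_apply, Finset.sum_smul, TensorProduct.tmul_sum, mul_smul]
  simpa [act, mul_smul] using h.symm

variable (V) in
/-- The convolution algebra of linear maps `C → B` acts on `C ⊗ V` by `twist`. -/
def twistHom : WithConv (C →ₗ[R] B) →* Module.End R (C ⊗[R] V) where
  toFun f := twist V f.ofConv
  map_one' := twist_one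
  map_mul' := twist_mul

variable (V) in
/-- The automorphism `twist V f` of `C ⊗ V`, for a convolution-invertible `f`. -/
def twistEquiv (f : (WithConv (C →ₗ[R] B))ˣ) : C ⊗[R] V ≃ₗ[R] C ⊗[R] V :=
  LinearMap.GeneralLinearGroup.toLinearEquiv (f.map (twistHom V))

end Twist

section Coopposite

variable {R C : Type*} [CommRing R] [AddCommGroup C] [Module R C] [Coalgebra R C]

/-- A copy of `C` that carries the coopposite coalgebra structure `c ↦ ∑ c₂ ⊗ c₁`. -/
def Coopposite (C : Type*) : Type _ := C

namespace Coopposite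

instance : AddCommGroup (Coopposite C) := inferInstanceAs (AddCommGroup C)

instance : Module R (Coopposite C) := inferInstanceAs (Module R C)

variable (R C) in
/-- The identity map. -/
def equiv : Coopposite C ≃ₗ[R] C := LinearEquiv.refl R C

instance : CoalgebraStruct R (Coopposite C) where
  comul := TensorProduct.map (equiv R C).symm.toLinearMap (equiv R C).symm.toLinearMap ∘ₗ
    (TensorProduct.comm R C C).toLinearMap ∘ₗ comul ∘ₗ (equiv R C).toLinearMap
  counit := counit ∘ₗ (equiv R C).toLinearMap

theorem counit_equiv_symm (c : C) : counit (R := R) ((equiv R C).symm c) = counit (R := R) c := rfl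

/-- The decomposition `∑ c₂ ⊗ c₁` of the coopposite comultiplication. -/
def repr {c : C} {ι : Type*} (r : Coalgebra.Repr R c ι) :
    Coalgebra.Repr R ((equiv R C).symm c) ι where
  index := r.index
  left i := (equiv R C).symm (r.right i)
  right i := (equiv R C).symm (r.left i)
  eq := by
    change _ = TensorProduct.map _ _ (TensorProduct.comm R C C (Coalgebra.comul c))
    simp [← r.eq]

theorem comul_equiv_symm (c : C) : comul (R := R) ((equiv R C).symm c) =
    ∑ i ∈ (ℛ R c).index, (equiv R C).symm ((ℛ R c).right i) ⊗ₜ (equiv R C).symm ((ℛ R c).left i) :=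
  (repr (ℛ R c)).eq.symm

instance : Coalgebra R (Coopposite C) where
  coassoc := LinearMap.ext fun c => by
    obtain ⟨c, rfl⟩ := (equiv R C).symm.surjective c
    let e := (equiv R C).symm.toLinearMap
    let reverse : C ⊗[R] (C ⊗[R] C) →ₗ[R] Coopposite C ⊗[R] (Coopposite C ⊗[R] Coopposite C) :=
      TensorProduct.map e (TensorProduct.map e e) ∘ₗ (TensorProduct.assoc R C C C).toLinearMap ∘ₗ
        (TensorProduct.comm R C (C ⊗[R] C)).toLinearMap ∘ₗ
        (TensorProduct.comm R C C).toLinearMap.lTensor C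
    have h := congrArg reverse
      (sum_tmul_tmul_eq (ℛ R c) (fun i => ℛ R ((ℛ R c).left i)) fun i => ℛ R ((ℛ R c).right i))
    simpa [comul_equiv_symm, reverse, e, TensorProduct.sum_tmul, TensorProduct.tmul_sum]
      using h.symm
  rTensor_counit_comp_comul := LinearMap.ext fun c => by
    obtain ⟨c, rfl⟩ := (equiv R C).symm.surjective c
    have h := congrArg (TensorProduct.map .id (equiv R C).symm.toLinearMap ∘ₗ
      (TensorProduct.comm R C R).toLinearMap) (sum_tmul_counit_eq (ℛ R c))
    rw [map_sum] at h
    rwa [LinearMap.comp_apply, comul_equiv_symm, map_sum]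
  lTensor_counit_comp_comul := LinearMap.ext fun c => by
    obtain ⟨c, rfl⟩ := (equiv R C).symm.surjective c
    have h := congrArg (TensorProduct.map (equiv R C).symm.toLinearMap .id ∘ₗ
      (TensorProduct.comm R R C).toLinearMap) (sum_counit_tmul_eq (ℛ R c))
    rw [map_sum] at h
    rwa [LinearMap.comp_apply, comul_equiv_symm, map_sum]

end Coopposite

end Coopposite

end Convolution

/-! ### Integrals of finite-dimensional Hopf algebras -/

section HopfAlgebra

open Coalgebra HopfAlgebra WithConv

section Antipode

variable {k H : Type*} [CommRing k] [Ring H] [HopfAlgebra k H]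

theorem sum_antipode_tmul_one_mul_comul {h : H} {ι : Type*} (r : Repr k h ι) :
    ∑ i ∈ r.index, (antipode k (r.left i) ⊗ₜ[k] (1 : H)) * comul (r.right i) = 1 ⊗ₜ h := by
  let antipodeMul : H ⊗[k] H →ₗ[k] H := LinearMap.mul' k H ∘ₗ (antipode k).rTensor H
  let contract : H ⊗[k] (H ⊗[k] H) →ₗ[k] H ⊗[k] H :=
    antipodeMul.rTensor H ∘ₗ (TensorProduct.assoc k H H H).symm.toLinearMap
  have hcontract (a : H) (t : H ⊗[k] H) :
      contract (a ⊗ₜ t) = (antipode k a ⊗ₜ[k] (1 : H)) * t := by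
    induction t using TensorProduct.induction_on with
    | zero => simp
    | add s t hs ht => rw [TensorProduct.tmul_add, map_add, hs, ht, mul_add]
    | tmul b c => simp [contract, antipodeMul]
  have hcounit : antipodeMul ∘ₗ comul = Algebra.linearMap k H ∘ₗ counit :=
    mul_antipode_rTensor_comul
  calc ∑ i ∈ r.index, (antipode k (r.left i) ⊗ₜ[k] (1 : H)) * comul (r.right i)
      = contract (comul.lTensor H (comul h)) := by simp [← r.eq, hcontract]
    _ = (antipodeMul ∘ₗ comul).rTensor H (comul h) := by
        rw [LinearMap.comp_apply, LinearEquiv.coe_coe, coassoc_symm_apply,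
          ← LinearMap.rTensor_comp_apply]
    _ = 1 ⊗ₜ h := by
        rw [hcounit, LinearMap.rTensor_comp_apply, rTensor_counit_comul]
        simp

variable (k H) in
/-- The map `x ↦ ∑ x₁ ⊗ S(x₂)`. Its value at an integral is a Casimir element of `H`. -/
def comulAntipode : H →ₗ[k] H ⊗[k] H :=
  (antipode k).lTensor H ∘ₗ comul

theorem comulAntipode_eq_sum {x : H} {ι : Type*} (r : Repr k x ι) :
    comulAntipode k H x = ∑ i ∈ r.index, r.left i ⊗ₜ[k] antipode k (r.right i) := by
  simp [comulAntipode, ← r.eq]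

variable (k H) in
/-- The identity of `H` as a unit of the convolution algebra, with inverse the antipode. -/
def idUnit : (WithConv (H →ₗ[k] H))ˣ where
  val := toConv LinearMap.id
  inv := toConv (antipode k)
  val_inv := LinearMap.id_mul_antipode
  inv_val := LinearMap.antipode_mul_id

end Antipode

variable {k H : Type u} [Field k] [Ring H] [HopfAlgebra k H] {Λ : H}

namespace IsLeftIntegral

theorem one_tmul_mul_comul (hΛ : IsLeftIntegral k Λ) (h : H) :
    ((1 : H) ⊗ₜ[k] h) * comul (R := k) Λ = (antipode k h ⊗ₜ[k] (1 : H)) * comul (R := k) Λ := by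
  have hcomul (x : H) : comul (R := k) x * comul (R := k) Λ = counit (R := k) x • comul Λ := by
    rw [← Bialgebra.comul_mul, hΛ.mul_eq, map_smul]
  have hcounit : ∑ i ∈ (ℛ k h).index, counit (R := k) ((ℛ k h).right i) • (ℛ k h).left i = h := by
    simpa only [map_sum, TensorProduct.rid_tmul, one_smul] using
      congrArg (TensorProduct.rid k H) (sum_tmul_counit_eq (ℛ k h))
  calc ((1 : H) ⊗ₜ[k] h) * comul Λ
      = ∑ i ∈ (ℛ k h).index, counit (R := k) ((ℛ k h).right i) •
          ((antipode k ((ℛ k h).left i) ⊗ₜ[k] (1 : H)) * comul Λ) := by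
        simp only [← sum_antipode_tmul_one_mul_comul (ℛ k h), Finset.sum_mul, mul_assoc, hcomul,
          mul_smul_comm]
    _ = (antipode k h ⊗ₜ[k] (1 : H)) * comul Λ := by
        conv_rhs => rw [← hcounit]
        simp only [map_sum, map_smul, TensorProduct.sum_tmul, Finset.sum_mul,
          ← TensorProduct.smul_tmul', smul_mul_assoc]

end IsLeftIntegral

/-- The map `f ↦ ∑ f(Λ₁) Λ₂` from the dual of `H` to `H`. -/
def contractLeft (Λ : H) : Module.Dual k H →ₗ[k] H :=
  (TensorProduct.lid k H).toLinearMap ∘ₗ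
    LinearMap.applyₗ (comul (R := k) Λ) ∘ₗ LinearMap.rTensorHom H

theorem contractLeft_apply (f : Module.Dual k H) :
    contractLeft Λ f = TensorProduct.lid k H (f.rTensor H (comul Λ)) := rfl

theorem contractLeft_eq_sum {ι : Type*} (r : Repr k Λ ι) (f : Module.Dual k H) :
    contractLeft Λ f = ∑ i ∈ r.index, f (r.left i) • r.right i := by
  simp [contractLeft_apply, ← r.eq]

/-- The map `f ↦ ∑ f(Λ₂) Λ₁` from the dual of `H` to `H`. -/
def contractRight (Λ : H) : Module.Dual k H →ₗ[k] H :=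
  (TensorProduct.rid k H).toLinearMap ∘ₗ
    LinearMap.applyₗ (comul (R := k) Λ) ∘ₗ LinearMap.lTensorHom H

theorem contractRight_eq_sum {ι : Type*} (r : Repr k Λ ι) (f : Module.Dual k H) :
    contractRight Λ f = ∑ i ∈ r.index, f (r.right i) • r.left i := by
  have hdef : contractRight Λ f = TensorProduct.rid k H (f.lTensor H (comul Λ)) := rfl
  simp [hdef, ← r.eq]

theorem IsLeftIntegral.mul_contractLeft (hΛ : IsLeftIntegral k Λ) (h : H) (f : Module.Dual k H) :
    h * contractLeft Λ f = contractLeft Λ (f ∘ₗ LinearMap.mulLeft k (antipode k h)) := by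
  have hmul := congrArg (fun t => TensorProduct.lid k H (f.rTensor H t)) (hΛ.one_tmul_mul_comul h)
  rw [← (ℛ k Λ).eq] at hmul
  simpa [contractLeft_eq_sum (ℛ k Λ), Finset.mul_sum] using hmul

/-- Convolution with the antipode turns a functional with value `1` at `x` into such a `g`. -/
theorem exists_mul'_rTensor_comul_eq_one {x : H} (hx : x ≠ 0) :
    ∃ g : H →ₗ[k] H, LinearMap.mul' k H (g.rTensor H (comul x)) = 1 := by
  obtain ⟨f, hf⟩ := Module.Projective.exists_dual_eq_one k hx
  let η : WithConv (H →ₗ[k] H) := toConv (Algebra.linearMap k H ∘ₗ f)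
  have hη : η * toConv (antipode k) * toConv LinearMap.id = η := by
    rw [mul_assoc, LinearMap.antipode_mul_id, mul_one]
  refine ⟨(η * toConv (antipode k)).ofConv, ?_⟩
  calc LinearMap.mul' k H ((η * toConv (antipode k)).ofConv.rTensor H (comul x))
      = (η * toConv (antipode k) * toConv LinearMap.id : WithConv (H →ₗ[k] H)) x := rfl
    _ = algebraMap k H (f x) := by rw [hη]; rfl
    _ = 1 := by rw [hf, map_one]

variable [FiniteDimensional k H]

theorem IsLeftIntegral.contractLeft_surjective (hΛ : IsLeftIntegral k Λ) :
    Function.Surjective (contractLeft (k := k) Λ) := by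
  suffices hone : (1 : H) ∈ LinearMap.range (contractLeft (k := k) Λ) by
    obtain ⟨f, hf⟩ := hone
    exact fun y => ⟨_, by rw [← hΛ.mul_contractLeft y f, hf, mul_one]⟩
  obtain ⟨g, hg⟩ := exists_mul'_rTensor_comul_eq_one (k := k) hΛ.ne_zero
  let b := Module.finBasis k H
  have hexpand (t : H ⊗[k] H) : LinearMap.mul' k H (g.rTensor H t) =
      ∑ j, g (b j) * TensorProduct.lid k H ((b.coord j).rTensor H t) := by
    induction t using TensorProduct.induction_on with
    | zero => simp
    | add s t hs ht => simp only [map_add, mul_add, Finset.sum_add_distrib, hs, ht]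
    | tmul x y =>
      conv_lhs => rw [LinearMap.rTensor_tmul, ← b.sum_repr x, map_sum, TensorProduct.sum_tmul]
      simp
  rw [← hg, hexpand]
  exact Submodule.sum_mem _ fun j _ => ⟨_, (hΛ.mul_contractLeft (g (b j)) (b.coord j)).symm⟩

theorem IsLeftIntegral.contractLeft_injective (hΛ : IsLeftIntegral k Λ) :
    Function.Injective (contractLeft (k := k) Λ) :=
  (LinearMap.injective_iff_surjective_of_finrank_eq_finrank
    Subspace.dual_finrank_eq).2 hΛ.contractLeft_surjective

variable {l : Module.Dual k H}

theorem IsLeftIntegral.antipode_bijective (hΛ : IsLeftIntegral k Λ) :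
    Function.Bijective (antipode k (A := H)) := by
  obtain ⟨l, hl⟩ := hΛ.contractLeft_surjective 1
  have hinj : Function.Injective (antipode k (A := H)) := by
    refine (injective_iff_map_eq_zero _).2 fun h hh => ?_
    have hmul := hΛ.mul_contractLeft h l
    rwa [hl, mul_one, hh, LinearMap.mulLeft_zero_eq_zero, LinearMap.comp_zero, map_zero] at hmul
  exact ⟨hinj, LinearMap.injective_iff_surjective.1 hinj⟩

/-- The inverse of the antipode. -/
def antipodeInv (hΛ : IsLeftIntegral k Λ) : H →ₗ[k] H :=
  (LinearEquiv.ofBijective (antipode k) hΛ.antipode_bijective).symm.toLinearMap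

@[simp]
theorem antipode_antipodeInv (hΛ : IsLeftIntegral k Λ) (x : H) :
    antipode k (antipodeInv hΛ x) = x :=
  (LinearEquiv.ofBijective (antipode k) hΛ.antipode_bijective).apply_symm_apply x

@[simp]
theorem antipodeInv_antipode (hΛ : IsLeftIntegral k Λ) (x : H) :
    antipodeInv hΛ (antipode k x) = x :=
  (LinearEquiv.ofBijective (antipode k) hΛ.antipode_bijective).symm_apply_apply x

theorem IsLeftIntegral.tmul_one_mul_comulAntipode (hΛ : IsLeftIntegral k Λ) (h : H) :
    (h ⊗ₜ[k] (1 : H)) * comulAntipode k H Λ = comulAntipode k H Λ * ((1 : H) ⊗ₜ[k] h) := by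
  have hcomul : (h ⊗ₜ[k] (1 : H)) * comul (R := k) Λ =
      ((1 : H) ⊗ₜ[k] antipodeInv hΛ h) * comul (R := k) Λ := by
    rw [hΛ.one_tmul_mul_comul, antipode_antipodeInv]
  have hantipode := congrArg ((antipode k).lTensor H) hcomul
  rw [← (ℛ k Λ).eq] at hantipode
  simpa [comulAntipode_eq_sum (ℛ k Λ), Finset.mul_sum, Finset.sum_mul, antipode_mul_antidistrib]
    using hantipode

/-- The Casimir element `∑ Λ₁ ⊗ S(Λ₂)` is dual to the form `l`. -/
theorem IsLeftIntegral.contractRight_mulRight_antipode (hΛ : IsLeftIntegral k Λ)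
    (hl : contractLeft Λ l = 1) (y : H) :
    contractRight Λ (l ∘ₗ LinearMap.mulRight k y ∘ₗ antipode k) = y := by
  rw [← sub_eq_zero, ← Module.forall_dual_apply_eq_zero_iff k]
  intro f
  have hform : l ∘ₗ LinearMap.mulLeft k (antipode k (contractLeft Λ f)) = f := by
    apply hΛ.contractLeft_injective
    rw [← hΛ.mul_contractLeft, hl, mul_one]
  rw [map_sub, sub_eq_zero]
  conv_rhs => rw [← hform]
  simp [contractLeft_eq_sum (ℛ k Λ), contractRight_eq_sum (ℛ k Λ), Finset.sum_mul, mul_comm]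

theorem IsLeftIntegral.mul_contractRight (hΛ : IsLeftIntegral k Λ) (h : H) (f : Module.Dual k H) :
    h * contractRight Λ (f ∘ₗ antipode k) =
      contractRight Λ (f ∘ₗ LinearMap.mulRight k h ∘ₗ antipode k) := by
  have hcasimir := congrArg (fun t => TensorProduct.rid k H (f.lTensor H t))
    (hΛ.tmul_one_mul_comulAntipode h)
  simpa [comulAntipode_eq_sum (ℛ k Λ), contractRight_eq_sum (ℛ k Λ), Finset.mul_sum,
    Finset.sum_mul] using hcasimir

/-- The element `∑ l(S²(Λ₂)) Λ₁` measures how far `∑ Λ₁ ⊗ Λ₂` is from being symmetric up to `S²`. -/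
theorem IsLeftIntegral.comul_mul_one_tmul_contractRight (hΛ : IsLeftIntegral k Λ)
    (hl : contractLeft Λ l = 1) :
    comul Λ * ((1 : H) ⊗ₜ[k] contractRight Λ (l ∘ₗ antipode k ∘ₗ antipode k)) =
      TensorProduct.comm k H H ((antipode k ∘ₗ antipode k).lTensor H (comul Λ)) := by
  let r := ℛ k Λ
  have hexpand (h : H) : h * contractRight Λ (l ∘ₗ antipode k ∘ₗ antipode k) =
      ∑ j ∈ r.index, l (antipode k h * antipode k (antipode k (r.right j))) • r.left j := by
    have := hΛ.mul_contractRight h (l ∘ₗ antipode k)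
    simpa [contractRight_eq_sum r, antipode_mul_antidistrib] using this
  calc comul Λ * ((1 : H) ⊗ₜ[k] contractRight Λ (l ∘ₗ antipode k ∘ₗ antipode k))
      = ∑ j ∈ r.index, contractRight Λ
          (l ∘ₗ LinearMap.mulRight k (antipode k (antipode k (r.right j))) ∘ₗ antipode k) ⊗ₜ[k]
            r.left j := by
        simp only [← r.eq, contractRight_eq_sum r, Finset.sum_mul, TensorProduct.sum_tmul,
          Algebra.TensorProduct.tmul_mul_tmul, mul_one]
        rw [Finset.sum_comm]
        refine Finset.sum_congr rfl fun i _ => ?_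
        rw [← contractRight_eq_sum r, hexpand]
        simp [TensorProduct.tmul_sum, TensorProduct.smul_tmul]
    _ = TensorProduct.comm k H H ((antipode k ∘ₗ antipode k).lTensor H (comul Λ)) := by
        simp [hΛ.contractRight_mulRight_antipode hl, ← r.eq]

theorem IsLeftIntegral.isUnit_contractRight (hΛ : IsLeftIntegral k Λ)
    (hl : contractLeft Λ l = 1) :
    IsUnit (contractRight Λ (l ∘ₗ antipode k ∘ₗ antipode k)) := by
  have : IsNoetherianRing H := IsNoetherianRing.of_finite k H
  refine IsUnit.of_mul_eq_one_right (contractLeft Λ (l ∘ₗ antipodeInv hΛ)) ?_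
  have hcomul := congrArg
    (fun t => TensorProduct.lid k H ((l ∘ₗ antipodeInv hΛ).rTensor H t))
    (hΛ.comul_mul_one_tmul_contractRight hl)
  have hone := hΛ.contractRight_mulRight_antipode hl 1
  simp only [contractRight_eq_sum (ℛ k Λ), contractLeft_eq_sum (ℛ k Λ),
    LinearMap.comp_apply, LinearMap.mulRight_apply, mul_one] at hone ⊢
  rw [← (ℛ k Λ).eq] at hcomul
  simpa [Finset.sum_mul, hone, contractRight_eq_sum (ℛ k Λ)] using hcomul

/-- The map `x ↦ ∑ x₂ ⊗ S⁻¹(x₁)`. -/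
def comulAntipodeInv (hΛ : IsLeftIntegral k Λ) : H →ₗ[k] H ⊗[k] H :=
  (TensorProduct.comm k H H).toLinearMap ∘ₗ (antipodeInv hΛ).rTensor H ∘ₗ comul

theorem IsLeftIntegral.exists_unit_comulAntipodeInv_mul (hΛ : IsLeftIntegral k Λ) :
    ∃ u : Hˣ, comulAntipodeInv hΛ Λ * ((u : H) ⊗ₜ[k] (1 : H)) = comulAntipode k H Λ := by
  obtain ⟨l, hl⟩ := hΛ.contractLeft_surjective 1
  obtain ⟨u, hu⟩ := hΛ.isUnit_contractRight hl
  have hcomm := congrArg (fun t => TensorProduct.comm k H H ((antipodeInv hΛ).rTensor H t))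
    (hΛ.comul_mul_one_tmul_contractRight hl)
  refine ⟨u, ?_⟩
  rw [← hu, ← (ℛ k Λ).eq] at hcomm
  rw [comulAntipode_eq_sum (ℛ k Λ), comulAntipodeInv, LinearMap.comp_apply, LinearMap.comp_apply,
    ← (ℛ k Λ).eq]
  simpa [Finset.sum_mul] using hcomm

/-- The identity of `H` as a unit of the convolution algebra of the coopposite coalgebra, with
inverse the inverse of the antipode. -/
def cooppositeUnit (hΛ : IsLeftIntegral k Λ) : (WithConv (Coopposite H →ₗ[k] H))ˣ where
  val := toConv (Coopposite.equiv k H).toLinearMap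
  inv := toConv (antipodeInv hΛ ∘ₗ (Coopposite.equiv k H).toLinearMap)
  val_inv := by
    ext x
    obtain ⟨x, rfl⟩ := (Coopposite.equiv k H).symm.surjective x
    apply hΛ.antipode_bijective.1
    have h := sum_mul_antipode_eq_algebraMap_counit (R := k) (ℛ k x)
    rw [(Coopposite.repr (ℛ k x)).convMul_apply]
    simpa [antipode_mul_antidistrib, Algebra.algebraMap_eq_smul_one, Coopposite.repr,
      Coopposite.counit_equiv_symm] using h
  inv_val := by
    ext x
    obtain ⟨x, rfl⟩ := (Coopposite.equiv k H).symm.surjective x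
    apply hΛ.antipode_bijective.1
    have h := sum_antipode_mul_eq_algebraMap_counit (R := k) (ℛ k x)
    rw [(Coopposite.repr (ℛ k x)).convMul_apply]
    simpa [antipode_mul_antidistrib, Algebra.algebraMap_eq_smul_one, Coopposite.repr,
      Coopposite.counit_equiv_symm] using h

end HopfAlgebra

/-! ### Tensor products of modules -/

section Tensor

open Coalgebra

variable {k : Type u} {H : Type u} {A : Type u} [Field k] [Ring H] [HopfAlgebra k H]
  [Ring A] [Algebra k A]

/-- The orbit map `a ↦ a • m`, as a `k`-linear map. -/
abbrev orbitMap (k : Type u) [Field k] [Algebra k A] {M : ModuleCat.{u} A} (m : M) : A →ₗ[k] M :=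
  (LinearMap.toSpanSingleton A M m).restrictScalars k

theorem tensorActionAux_tmul {V : ModuleCat.{u} H} {M : ModuleCat.{u} A} (t : H ⊗[k] A) (v : V)
    (m : M) : tensorActionAux k V M t (v ⊗ₜ[k] m) =
      TensorProduct.map (orbitMap k v) (orbitMap k m) t := by
  induction t using TensorProduct.induction_on with
  | zero => simp
  | add s t hs ht => rw [map_add, map_add, LinearMap.add_apply, hs, ht]
  | tmul h a => rfl

variable [LeftComoduleAlgebra k H A]

theorem tensorObj_induction {V : ModuleCat.{u} H} {M : ModuleCat.{u} A}
    {motive : tensorObj k V M → Prop} (zero : motive 0) (tmul : ∀ v m, motive (tmul v m))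
    (add : ∀ x y, motive x → motive y → motive (x + y)) (x : tensorObj k V M) : motive x :=
  TensorProduct.induction_on (motive := motive) x zero tmul add

variable (k) in
/-- The identity map, as a `k`-linear equivalence between the `k`-module underlying the `A`-module
`V ⊗ M` and the tensor product over `k`. The two `k`-module structures are not definitionally
equal. -/
def tensorEquiv (V : ModuleCat.{u} H) (M : ModuleCat.{u} A) :
    tensorObj k V M ≃ₗ[k] V ⊗[k] M where
  toFun x := x
  invFun x := x
  left_inv _ := rfl
  right_inv _ := rfl
  map_add' _ _ := rfl
  map_smul' c x := by
    let y : V ⊗[k] M := x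
    change tensorAction k V M (algebraMap k A c) y = c • y
    rw [AlgHom.commutes]
    rfl

theorem orbitMap_tmul {V : ModuleCat.{u} H} {M : ModuleCat.{u} A} (v : V) (m : M) :
    orbitMap k (tmul v m : tensorObj k V M) = (tensorEquiv k V M).symm.toLinearMap ∘ₗ
      TensorProduct.map (orbitMap k v) (orbitMap k m) ∘ₗ
        (LeftComoduleAlgebra.coact (k := k) (H := H)).toLinearMap :=
  LinearMap.ext fun _ => tensorActionAux_tmul _ v m

variable (k) in
/-- The `k`-linear map underlying the associator. -/
def assocLinearEquiv (V W : ModuleCat.{u} H) (M : ModuleCat.{u} A) :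
    tensorObj k (tensorObj k V W) M ≃ₗ[k] tensorObj k V (tensorObj k W M) :=
  tensorEquiv k _ M ≪≫ₗ TensorProduct.congr (tensorEquiv k V W) (.refl k M) ≪≫ₗ
    TensorProduct.assoc k V W M ≪≫ₗ
      TensorProduct.congr (.refl k V) (tensorEquiv k W M).symm ≪≫ₗ (tensorEquiv k V _).symm

theorem assocLinearEquiv_smul_tmul {V W : ModuleCat.{u} H} {M : ModuleCat.{u} A} (a : A) (v : V)
    (w : W) (m : M) :
    assocLinearEquiv k V W M (a • tmul (tmul v w : tensorObj k V W) m) =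
      a • tmul v (tmul w m : tensorObj k W M) := by
  let coact : A →ₗ[k] H ⊗[k] A := LeftComoduleAlgebra.coact.toLinearMap
  let e : V ⊗[k] (W ⊗[k] M) ≃ₗ[k] tensorObj k V (tensorObj k W M) :=
    TensorProduct.congr (.refl k V) (tensorEquiv k W M).symm ≪≫ₗ (tensorEquiv k V _).symm
  let orbits : H ⊗[k] (H ⊗[k] A) →ₗ[k] tensorObj k V (tensorObj k W M) :=
    e.toLinearMap ∘ₗ
      TensorProduct.map (orbitMap k v) (TensorProduct.map (orbitMap k w) (orbitMap k m))
  have hleft : (assocLinearEquiv k V W M).toLinearMap ∘ₗ (tensorEquiv k _ M).symm.toLinearMap ∘ₗ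
      TensorProduct.map (orbitMap k (tmul v w)) (orbitMap k m) =
        orbits ∘ₗ (TensorProduct.assoc k H H A).toLinearMap ∘ₗ comul.rTensor A := by
    refine TensorProduct.ext' fun h b => ?_
    rw [orbitMap_tmul]
    have hcomul : LeftComoduleAlgebra.coact (k := k) (H := H) h = comul h := rfl
    simp [hcomul, ← (ℛ k h).eq, TensorProduct.sum_tmul, assocLinearEquiv, orbits, e]
  have hright : (tensorEquiv k V _).symm.toLinearMap ∘ₗ
      TensorProduct.map (orbitMap k v) (orbitMap k (tmul w m)) = orbits ∘ₗ coact.lTensor H := by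
    refine TensorProduct.ext' fun h b => ?_
    simp [orbitMap_tmul, orbits, e, coact]
  calc assocLinearEquiv k V W M (a • tmul (tmul v w : tensorObj k V W) m)
      = assocLinearEquiv k V W M ((tensorEquiv k _ M).symm
          (TensorProduct.map (orbitMap k (tmul v w)) (orbitMap k m) (coact a))) :=
        congrArg _ (LinearMap.congr_fun (orbitMap_tmul _ m) a)
    _ = orbits (TensorProduct.assoc k H H A (comul.rTensor A (coact a))) :=
        LinearMap.congr_fun hleft _
    _ = orbits (coact.lTensor H (coact a)) :=
        congrArg orbits (LeftComoduleAlgebra.coassoc a)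
    _ = (tensorEquiv k V _).symm
          (TensorProduct.map (orbitMap k v) (orbitMap k (tmul w m)) (coact a)) :=
        (LinearMap.congr_fun hright _).symm
    _ = a • tmul v (tmul w m : tensorObj k W M) :=
        (LinearMap.congr_fun (orbitMap_tmul v _) a).symm

theorem assocLinearEquiv_smul (V W : ModuleCat.{u} H) (M : ModuleCat.{u} A) (a : A)
    (x : tensorObj k (tensorObj k V W) M) :
    assocLinearEquiv k V W M (a • x) = a • assocLinearEquiv k V W M x := by
  induction x using tensorObj_induction with
  | zero => simp
  | add x y hx hy => simp only [smul_add, map_add, hx, hy]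
  | tmul y m =>
    induction y using tensorObj_induction with
    | zero => simp only [zero_tmul, smul_zero, map_zero]
    | add y z hy hz => simp only [add_tmul, smul_add, map_add, hy, hz]
    | tmul v w => exact assocLinearEquiv_smul_tmul a v w m

variable (k) in
/-- The associativity isomorphism `(V ⊗ W) ⊗ M ≅ V ⊗ (W ⊗ M)` of `A`-modules. -/
def associator (V W : ModuleCat.{u} H) (M : ModuleCat.{u} A) :
    tensorObj k (tensorObj k V W) M ≅ tensorObj k V (tensorObj k W M) :=
  let e : tensorObj k (tensorObj k V W) M ≃ₗ[A] tensorObj k V (tensorObj k W M) :=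
    { (assocLinearEquiv k V W M).toAddEquiv with
      map_smul' := assocLinearEquiv_smul V W M }
  e.toModuleIso

theorem tensor_ext₃ {V W : ModuleCat.{u} H} {M N : ModuleCat.{u} A}
    {f g : tensorObj k (tensorObj k V W) M ⟶ N}
    (h : ∀ (v : V) (w : W) (m : M), f.hom (tmul (tmul v w : tensorObj k V W) m) =
      g.hom (tmul (tmul v w : tensorObj k V W) m)) : f = g := by
  refine tensor_ext fun y m => ?_
  induction y using tensorObj_induction with
  | zero => rw [zero_tmul, map_zero, map_zero]
  | tmul v w => exact h v w m
  | add x y hx hy => rw [add_tmul, map_add, map_add, hx, hy]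

variable (k)

theorem associator_naturality {V V' W W' : ModuleCat.{u} H} {M M' : ModuleCat.{u} A} (f : V ⟶ V')
    (g : W ⟶ W') (h : M ⟶ M') :
    tensorHom k (tensorHom k f g) h ≫ (associator k V' W' M').hom =
      (associator k V W M).hom ≫ tensorHom k f (tensorHom k g h) :=
  tensor_ext₃ fun _ _ _ => rfl

theorem tensorHom_comp {V V' V'' : ModuleCat.{u} H} {M M' M'' : ModuleCat.{u} A} (f : V ⟶ V')
    (f' : V' ⟶ V'') (g : M ⟶ M') (g' : M' ⟶ M'') :
    tensorHom k f g ≫ tensorHom k f' g' = tensorHom k (f ≫ f') (g ≫ g') :=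
  tensor_ext fun _ _ => rfl

theorem tensorHom_id (V : ModuleCat.{u} H) (M : ModuleCat.{u} A) :
    tensorHom k (𝟙 V) (𝟙 M) = 𝟙 (tensorObj k V M) :=
  tensor_ext fun _ _ => rfl

/-- The tensor product of isomorphisms. -/
@[simps]
def tensorIso {V V' : ModuleCat.{u} H} {M M' : ModuleCat.{u} A} (e : V ≅ V') (i : M ≅ M') :
    tensorObj k V M ≅ tensorObj k V' M' where
  hom := tensorHom k e.hom i.hom
  inv := tensorHom k e.inv i.inv
  hom_inv_id := by rw [tensorHom_comp, e.hom_inv_id, i.hom_inv_id, tensorHom_id]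
  inv_hom_id := by rw [tensorHom_comp, e.inv_hom_id, i.inv_hom_id, tensorHom_id]

/-- The functor `V ↦ V ⊗ M` from `H`-modules to `A`-modules. -/
def tensorRightFunctor (H : Type u) [Ring H] [HopfAlgebra k H] [LeftComoduleAlgebra k H A]
    (M : ModuleCat.{u} A) : ModuleCat.{u} H ⥤ ModuleCat.{u} A where
  obj V := tensorObj k V M
  map f := tensorHom k f (𝟙 M)
  map_id _ := tensorHom_id k _ _
  map_comp _ _ := tensor_ext fun _ _ => rfl

instance (M : ModuleCat.{u} A) : (tensorRightFunctor k H M).Additive where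
  map_add {_ _ f g} := tensor_ext fun v m => add_tmul k (f.hom v) (g.hom v) m

instance (V : ModuleCat.{u} H) : Limits.PreservesFiniteColimits
    (tensorFunctor k V : ModuleCat.{u} A ⥤ ModuleCat.{u} A) := by
  refine ((Functor.preservesFiniteColimits_tfae _).out 0 3).1 fun S hS => ?_
  have hg := hS.moduleCat_surjective_g
  have hfg := (ShortComplex.ShortExact.moduleCat_exact_iff_function_exact S).1 hS.exact
  exact ⟨(ShortComplex.ShortExact.moduleCat_exact_iff_function_exact _).2
      (lTensor_exact V (f := kLin k S.f) (g := kLin k S.g) hfg hg),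
    (ModuleCat.epi_iff_surjective _).2 (LinearMap.lTensor_surjective V (g := kLin k S.g) hg)⟩

instance (M : ModuleCat.{u} A) : Limits.PreservesFiniteColimits (tensorRightFunctor k H M) := by
  refine ((Functor.preservesFiniteColimits_tfae _).out 0 3).1 fun S hS => ?_
  have hg := hS.moduleCat_surjective_g
  have hfg := (ShortComplex.ShortExact.moduleCat_exact_iff_function_exact S).1 hS.exact
  exact ⟨(ShortComplex.ShortExact.moduleCat_exact_iff_function_exact _).2
      (rTensor_exact M (f := kLin k S.f) (g := kLin k S.g) hfg hg),
    (ModuleCat.epi_iff_surjective _).2 (LinearMap.rTensor_surjective M (g := kLin k S.g) hg)⟩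

end Tensor

/-! ### Free modules and the isomorphism `V ⊗ H ≅ H ⊗ V` -/

section Free

open Coalgebra HopfAlgebra WithConv

variable (k : Type u) {H : Type u} [Field k] [Ring H] [HopfAlgebra k H]

/-- The free `H`-module `H ⊗ V` on the vector space underlying `V`. -/
abbrev freeObj (V : ModuleCat.{u} H) : ModuleCat.{u} H := ModuleCat.of H (H ⊗[k] V)

variable {k}

theorem freeObj_hom_ext {V X : ModuleCat.{u} H} {f g : freeObj k V ⟶ X}
    (h : ∀ v, f.hom ((1 : H) ⊗ₜ v) = g.hom ((1 : H) ⊗ₜ v)) : f = g :=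
  ModuleCat.hom_ext (TensorProduct.AlgebraTensorModule.curry_injective
    (LinearMap.ext_ring (LinearMap.ext h)))

/-- The isomorphism of `H`-modules given by a `k`-linear equivalence that is `H`-linear on pure
tensors. -/
def freeObjIso {V X : ModuleCat.{u} H} (e : H ⊗[k] V ≃ₗ[k] X)
    (he : ∀ h v, e (h ⊗ₜ v) = h • e (1 ⊗ₜ v)) : freeObj k V ≅ X :=
  let e' : H ⊗[k] V ≃ₗ[H] X :=
    { e.toAddEquiv with
      map_smul' := fun h x => by
        change e (h • x) = h • e x
        induction x using TensorProduct.induction_on with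
        | zero => simp
        | add x y hx hy => simp only [smul_add, map_add, hx, hy]
        | tmul a v => rw [TensorProduct.smul_tmul', smul_eq_mul, he, mul_smul, ← he] }
  e'.toModuleIso

/-- The identification of `M ⊗ N` with the tensor product of two objects of `ModuleCat H`. It is
needed for `V = H`, where the `k`-module structure that `ModuleCat H` gives to `V` is not
definitionally that of `H`. -/
def tensorObjEquiv {M N : Type u} [AddCommGroup M] [Module H M] [Module k M] [IsScalarTower k H M]
    [AddCommGroup N] [Module H N] [Module k N] [IsScalarTower k H N] {V W : ModuleCat.{u} H}
    (e : M ≃ₗ[H] V) (f : N ≃ₗ[H] W) : M ⊗[k] N ≃ₗ[k] tensorObj k V W :=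
  TensorProduct.congr (e.restrictScalars k) (f.restrictScalars k) ≪≫ₗ (tensorEquiv k V W).symm

theorem smul_tmul_eq_sum {V W : ModuleCat.{u} H} {x : H} {ι : Type*} (r : Repr k x ι) (v : V)
    (w : W) : x • (tmul v w : tensorObj k V W) =
      ∑ i ∈ r.index, (tmul (r.left i • v) (r.right i • w) : tensorObj k V W) :=
  tensorObj_smul_tmul x r.index r.left r.right r.eq.symm v w

variable (k) in
/-- The `k`-linear equivalence `h ⊗ v ↦ ∑ h₁ ⊗ h₂v`. -/
def freeLeftLinearEquiv (V : ModuleCat.{u} H) : H ⊗[k] V ≃ₗ[k] tensorObj k (regular H) V :=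
  twistEquiv V (idUnit k H) ≪≫ₗ tensorObjEquiv (V := regular H) (.refl H H) (.refl H V)

theorem freeLeftLinearEquiv_tmul {V : ModuleCat.{u} H} (h : H) (v : V) :
    freeLeftLinearEquiv k V (h ⊗ₜ v) = h • tmul (V := regular H) (1 : H) v := by
  rw [smul_tmul_eq_sum (ℛ k h)]
  let e : H ⊗[k] V ≃ₗ[k] tensorObj k (regular H) V :=
    tensorObjEquiv (V := regular H) (.refl H H) (.refl H V)
  refine (congrArg e (twist_tmul _ (ℛ k h) v)).trans
    ((map_sum _ _ _).trans (Finset.sum_congr rfl fun i _ => ?_))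
  exact congrArg (fun x : H => tmul (V := regular H) x ((ℛ k h).right i • v)) (mul_one _).symm

theorem freeLeftLinearEquiv_symm_tmul {V : ModuleCat.{u} H} (x : H) (v : V) :
    (freeLeftLinearEquiv k V).symm (tmul (V := regular H) x v) =
      (orbitMap k v).lTensor H (comulAntipode k H x) := by
  rw [comulAntipode_eq_sum (ℛ k x), map_sum]
  exact twist_tmul (idUnit k H).inv.ofConv (ℛ k x) v

variable (k) in
/-- The isomorphism `h ⊗ v ↦ ∑ h₁ ⊗ h₂v` from the free module to the tensor product `H ⊗ V`. -/
def freeLeftIso (V : ModuleCat.{u} H) : freeObj k V ≅ tensorObj k (regular H) V :=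
  freeObjIso (freeLeftLinearEquiv k V) fun h v => by
    rw [freeLeftLinearEquiv_tmul, freeLeftLinearEquiv_tmul, one_smul]

theorem freeLeftIso_hom_one_tmul {V : ModuleCat.{u} H} (v : V) :
    (freeLeftIso k V).hom.hom ((1 : H) ⊗ₜ v) = tmul (V := regular H) (1 : H) v :=
  (freeLeftLinearEquiv_tmul 1 v).trans (one_smul H _)

/-- The map of free modules induced by `f`. -/
def freeMap {V W : ModuleCat.{u} H} (f : V ⟶ W) : freeObj k V ⟶ freeObj k W :=
  ModuleCat.ofHom (TensorProduct.AlgebraTensorModule.map (LinearMap.id : H →ₗ[H] H) (kLin k f))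

theorem freeLeftIso_naturality {V W : ModuleCat.{u} H} (f : V ⟶ W) :
    freeMap (k := k) f ≫ (freeLeftIso k W).hom =
      (freeLeftIso k V).hom ≫ tensorHom k (𝟙 (regular H)) f :=
  freeObj_hom_ext fun v => (freeLeftIso_hom_one_tmul (f.hom v)).trans
    (congrArg (tensorHom k (𝟙 (regular H)) f).hom (freeLeftIso_hom_one_tmul v)).symm

/-- The automorphism `h ⊗ v ↦ hu ⊗ v` of a free module. -/
def freeUnitIso (u : Hˣ) (V : ModuleCat.{u} H) : freeObj k V ≅ freeObj k V :=
  (TensorProduct.AlgebraTensorModule.congr (u.mulRightLinearEquiv H) (.refl k V)).toModuleIso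

theorem freeUnitIso_hom_lTensor (u : Hˣ) {V : ModuleCat.{u} H} (f : H →ₗ[k] V) (z : H ⊗[k] H) :
    (freeUnitIso u V).hom.hom (f.lTensor H z) = f.lTensor H (z * ((u : H) ⊗ₜ[k] (1 : H))) := by
  induction z using TensorProduct.induction_on with
  | zero => simp
  | add x y hx hy => rw [map_add, map_add, hx, hy, add_mul, map_add]
  | tmul a b => simp [freeUnitIso]

theorem freeUnitIso_naturality (u : Hˣ) {V W : ModuleCat.{u} H} (f : V ⟶ W) :
    freeMap (k := k) f ≫ (freeUnitIso u W).hom = (freeUnitIso u V).hom ≫ freeMap f :=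
  freeObj_hom_ext fun _ => rfl

variable [FiniteDimensional k H] {Λ : H} (hΛ : IsLeftIntegral k Λ)

/-- The `k`-linear equivalence `h ⊗ v ↦ ∑ h₁v ⊗ h₂`. -/
def freeRightLinearEquiv (V : ModuleCat.{u} H) : H ⊗[k] V ≃ₗ[k] tensorObj k V (regular H) :=
  (Coopposite.equiv k H).symm.rTensor V ≪≫ₗ
    twistEquiv V (cooppositeUnit hΛ) ≪≫ₗ TensorProduct.comm k (Coopposite H) V ≪≫ₗ
      (Coopposite.equiv k H).lTensor V ≪≫ₗ
        tensorObjEquiv (W := regular H) (.refl H V) (.refl H H)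

theorem freeRightLinearEquiv_tmul {V : ModuleCat.{u} H} (h : H) (v : V) :
    freeRightLinearEquiv hΛ V (h ⊗ₜ v) = h • tmul (M := regular H) v (1 : H) := by
  rw [smul_tmul_eq_sum (ℛ k h)]
  have hv := twist_tmul (cooppositeUnit hΛ).val.ofConv (Coopposite.repr (ℛ k h)) v
  let e := TensorProduct.comm k (Coopposite H) V ≪≫ₗ (Coopposite.equiv k H).lTensor V ≪≫ₗ
    tensorObjEquiv (W := regular H) (.refl H V) (.refl H H)
  refine (congrArg e hv).trans ((map_sum _ _ _).trans (Finset.sum_congr rfl fun i _ => ?_))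
  exact congrArg (fun x : H => tmul (M := regular H) ((ℛ k h).left i • v) x) (mul_one _).symm

theorem freeRightLinearEquiv_symm_tmul {V : ModuleCat.{u} H} (x : H) (v : V) :
    (freeRightLinearEquiv hΛ V).symm (tmul (M := regular H) v x) =
      (orbitMap k v).lTensor H (comulAntipodeInv hΛ x) := by
  have hv := twist_tmul (antipodeInv hΛ ∘ₗ (Coopposite.equiv k H).toLinearMap)
    (Coopposite.repr (ℛ k x)) v
  refine (congrArg ((Coopposite.equiv k H).rTensor V) hv).trans ?_
  rw [map_sum, comulAntipodeInv, LinearMap.comp_apply, LinearMap.comp_apply, ← (ℛ k x).eq]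
  simp [Coopposite.repr]

/-- The isomorphism `h ⊗ v ↦ ∑ h₁v ⊗ h₂` from the free module to the tensor product `V ⊗ H`. -/
def freeRightIso (V : ModuleCat.{u} H) : freeObj k V ≅ tensorObj k V (regular H) :=
  freeObjIso (freeRightLinearEquiv hΛ V) fun h v => by
    rw [freeRightLinearEquiv_tmul, freeRightLinearEquiv_tmul, one_smul]

theorem freeRightIso_hom_one_tmul {V : ModuleCat.{u} H} (v : V) :
    (freeRightIso hΛ V).hom.hom ((1 : H) ⊗ₜ v) = tmul (M := regular H) v (1 : H) :=
  (freeRightLinearEquiv_tmul hΛ 1 v).trans (one_smul H _)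

theorem freeRightIso_naturality {V W : ModuleCat.{u} H} (f : V ⟶ W) :
    freeMap (k := k) f ≫ (freeRightIso hΛ W).hom =
      (freeRightIso hΛ V).hom ≫ tensorHom k f (𝟙 (regular H)) :=
  freeObj_hom_ext fun v => (freeRightIso_hom_one_tmul hΛ (f.hom v)).trans
    (congrArg (tensorHom k f (𝟙 (regular H))).hom (freeRightIso_hom_one_tmul hΛ v)).symm

/-- A unit `u` with `∑ Λ₂u ⊗ S⁻¹(Λ₁) = ∑ Λ₁ ⊗ S(Λ₂)`. -/
def integralUnit : Hˣ := hΛ.exists_unit_comulAntipodeInv_mul.choose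

theorem comulAntipodeInv_mul_integralUnit :
    comulAntipodeInv hΛ Λ * ((integralUnit hΛ : H) ⊗ₜ[k] (1 : H)) = comulAntipode k H Λ :=
  hΛ.exists_unit_comulAntipodeInv_mul.choose_spec

/-- The isomorphism `V ⊗ H ≅ H ⊗ V` of the theorem: both sides are free on `V`, and right
multiplication by `integralUnit` matches the two embeddings of `V` given by `Λ`. -/
def swapIso (V : ModuleCat.{u} H) : tensorObj k V (regular H) ≅ tensorObj k (regular H) V :=
  (freeRightIso hΛ V).symm ≪≫ freeUnitIso (integralUnit hΛ) V ≪≫ freeLeftIso k V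

theorem swapIso_naturality {V W : ModuleCat.{u} H} (f : V ⟶ W) :
    tensorHom k f (𝟙 (regular H)) ≫ (swapIso hΛ W).hom =
      (swapIso hΛ V).hom ≫ tensorHom k (𝟙 (regular H)) f := by
  simp only [swapIso, Iso.trans_hom, Iso.symm_hom, Category.assoc, ← freeLeftIso_naturality]
  rw [← reassoc_of% freeUnitIso_naturality (integralUnit hΛ) f,
    ← cancel_epi (freeRightIso hΛ V).hom, Iso.hom_inv_id_assoc,
    ← reassoc_of% freeRightIso_naturality hΛ f, Iso.hom_inv_id_assoc]

theorem integralInclusionRight_swapIso (V : ModuleCat.{u} H) :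
    integralInclusionRight k hΛ V ≫ (swapIso hΛ V).hom = integralInclusion k hΛ V := by
  rw [← cancel_mono (freeLeftIso k V).inv]
  simp only [swapIso, Iso.trans_hom, Iso.symm_hom, Category.assoc, Iso.hom_inv_id,
    Category.comp_id]
  refine ModuleCat.hom_ext (LinearMap.ext fun v => ?_)
  change (freeUnitIso (integralUnit hΛ) V).hom.hom
    ((freeRightLinearEquiv hΛ V).symm (tmul (M := regular H) v Λ)) =
      (freeLeftLinearEquiv k V).symm (tmul (V := regular H) Λ v)
  rw [freeRightLinearEquiv_symm_tmul, freeLeftLinearEquiv_symm_tmul, freeUnitIso_hom_lTensor,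
    comulAntipodeInv_mul_integralUnit]

end Free

/-! ### Injectivity of free modules -/

section Average

open Coalgebra HopfAlgebra

variable {k H : Type u} [Field k] [Ring H] [HopfAlgebra k H]
variable {X Y Z : Type u} [AddCommGroup X] [Module k X] [Module H X] [IsScalarTower k H X]
  [AddCommGroup Y] [Module k Y] [Module H Y] [IsScalarTower k H Y]
  [AddCommGroup Z] [Module k Z] [Module H Z] [IsScalarTower k H Z]

variable (H) in
/-- The map `a ⊗ b ↦ (y ↦ a φ(by))`. -/
def sandwich (φ : Y →ₗ[k] Z) : H ⊗[k] H →ₗ[k] Y →ₗ[k] Z :=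
  TensorProduct.lift ((LinearMap.llcomp k Y Z Z ∘ₗ (Algebra.lsmul k k Z).toLinearMap).compl₂
    (LinearMap.llcomp k Y Y Z φ ∘ₗ (Algebra.lsmul k k Y).toLinearMap))

theorem sandwich_tmul_apply (φ : Y →ₗ[k] Z) (a b : H) (y : Y) :
    sandwich H φ (a ⊗ₜ b) y = a • φ (b • y) := rfl

theorem sandwich_tmul_one_mul (φ : Y →ₗ[k] Z) (h : H) (z : H ⊗[k] H) (y : Y) :
    sandwich H φ (h ⊗ₜ 1 * z) y = h • sandwich H φ z y := by
  induction z using TensorProduct.induction_on with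
  | zero => simp
  | add x y hx hy => simp only [mul_add, map_add, LinearMap.add_apply, hx, hy, smul_add]
  | tmul a b => simp [sandwich_tmul_apply, mul_smul]

theorem sandwich_mul_one_tmul (φ : Y →ₗ[k] Z) (h : H) (z : H ⊗[k] H) (y : Y) :
    sandwich H φ (z * 1 ⊗ₜ h) y = sandwich H φ z (h • y) := by
  induction z using TensorProduct.induction_on with
  | zero => simp
  | add x y hx hy => simp only [add_mul, map_add, LinearMap.add_apply, hx, hy]
  | tmul a b => simp [sandwich_tmul_apply, mul_smul]

variable [FiniteDimensional k H] {Λ : H} (hΛ : IsLeftIntegral k Λ)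

/-- The `H`-linear map `y ↦ ∑ Λ₁ φ(S(Λ₂)y)`. -/
def average (φ : Y →ₗ[k] Z) : Y →ₗ[H] Z where
  __ := sandwich H φ (comulAntipode k H Λ)
  map_smul' h y := by
    change sandwich H φ (comulAntipode k H Λ) (h • y) = h • sandwich H φ (comulAntipode k H Λ) y
    rw [← sandwich_mul_one_tmul, ← hΛ.tmul_one_mul_comulAntipode, sandwich_tmul_one_mul]

theorem average_apply (φ : Y →ₗ[k] Z) (y : Y) :
    average hΛ φ y = ∑ i ∈ (ℛ k Λ).index,
      (ℛ k Λ).left i • φ (antipode k ((ℛ k Λ).right i) • y) := by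
  change sandwich H φ (comulAntipode k H Λ) y = _
  simp only [comulAntipode_eq_sum (ℛ k Λ), map_sum, LinearMap.sum_apply, sandwich_tmul_apply]

theorem average_comp_restrictScalars (φ : Y →ₗ[k] Z) (f : X →ₗ[H] Y) :
    average hΛ (φ ∘ₗ f.restrictScalars k) = average hΛ φ ∘ₗ f := by
  ext x
  simp [average_apply]

include hΛ in
/-- Higman's criterion. -/
theorem injective_of_average_eq_id (e : Z →ₗ[k] Z) (he : average hΛ e = LinearMap.id) :
    Injective (ModuleCat.of H Z) where
  factors {X Y} g i hi := by
    obtain ⟨p, hp⟩ := LinearMap.exists_leftInverse_of_injective (kLin k i)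
      (LinearMap.ker_eq_bot.2 ((ModuleCat.mono_iff_injective i).1 hi))
    let g' : X →ₗ[H] Z := g.hom
    refine ⟨ModuleCat.ofHom (average hΛ (e ∘ₗ g'.restrictScalars k ∘ₗ p)), ModuleCat.hom_ext ?_⟩
    have hpi : (e ∘ₗ g'.restrictScalars k ∘ₗ p) ∘ₗ i.hom.restrictScalars k =
        e ∘ₗ g'.restrictScalars k := by
      rw [LinearMap.comp_assoc, LinearMap.comp_assoc]
      exact congrArg (fun q => e ∘ₗ g'.restrictScalars k ∘ₗ q) hp
    calc average hΛ (e ∘ₗ g'.restrictScalars k ∘ₗ p) ∘ₗ i.hom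
        = average hΛ (e ∘ₗ g'.restrictScalars k) := by rw [← average_comp_restrictScalars, hpi]
      _ = g.hom := by rw [average_comp_restrictScalars, he, LinearMap.id_comp]

include hΛ in
theorem injective_freeObj (N : ModuleCat.{u} H) : Injective (freeObj k N) := by
  obtain ⟨l, hl⟩ := hΛ.contractLeft_surjective 1
  refine injective_of_average_eq_id hΛ ((Algebra.linearMap k H ∘ₗ l).rTensor N) ?_
  refine LinearMap.ext fun z => ?_
  induction z using TensorProduct.induction_on with
  | zero => simp
  | add x y hx hy => rw [map_add, hx, hy, map_add]
  | tmul y n =>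
    have hy := hΛ.contractRight_mulRight_antipode hl y
    rw [contractRight_eq_sum (ℛ k Λ)] at hy
    conv_rhs => rw [← hy, LinearMap.id_apply, TensorProduct.sum_tmul]
    simp [average_apply, TensorProduct.smul_tmul', Algebra.algebraMap_eq_smul_one]

include hΛ in
theorem injective_tensorObj_regular (N : ModuleCat.{u} H) :
    Injective (tensorObj k (regular H) N) :=
  have := injective_freeObj hΛ N
  Injective.of_iso (freeLeftIso k N) this

end Average

/-! ### Unitors -/

section Unit

open Coalgebra

variable (k : Type u) {H : Type u} {A : Type u} [Field k] [Ring H] [HopfAlgebra k H]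
  [Ring A] [Algebra k A] [LeftComoduleAlgebra k H A]

/-- The identity map, as a `k`-linear equivalence from the trivial module to `k`. -/
def trivialEquiv (H : Type u) [Ring H] [HopfAlgebra k H] : trivialModule k H ≃ₗ[k] k where
  toFun x := x
  invFun x := x
  left_inv _ := rfl
  right_inv _ := rfl
  map_add' _ _ := rfl
  map_smul' c x := by
    let y : k := x
    change counit (R := k) (algebraMap k H c) * y = c * y
    rw [Bialgebra.counit_algebraMap]

variable {k}

theorem trivialEquiv_smul (h : H) (c : trivialModule k H) :
    trivialEquiv k H (h • c) = counit (R := k) h * trivialEquiv k H c := rfl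

/-- The isomorphism of `A`-modules given by a `k`-linear equivalence that commutes with the action
of `A` on pure tensors. -/
def isoOfTensorLinearEquiv {V : ModuleCat.{u} H} {M N : ModuleCat.{u} A}
    (e : tensorObj k V M ≃ₗ[k] N) (he : ∀ (a : A) v m, e (a • tmul v m) = a • e (tmul v m)) :
    tensorObj k V M ≅ N :=
  let e' : tensorObj k V M ≃ₗ[A] N :=
    { e.toAddEquiv with
      map_smul' := fun a x => by
        change e (a • x) = a • e x
        induction x using tensorObj_induction with
        | zero => simp
        | tmul v m => exact he a v m
        | add x y hx hy => simp only [smul_add, map_add, hx, hy] }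
  e'.toModuleIso

variable (k H) in
/-- The `k`-linear map underlying the left unitor. -/
def leftUnitorLinearEquiv (M : ModuleCat.{u} A) : tensorObj k (trivialModule k H) M ≃ₗ[k] M :=
  tensorEquiv k _ M ≪≫ₗ (trivialEquiv k H).rTensor M ≪≫ₗ TensorProduct.lid k M

theorem leftUnitorLinearEquiv_smul_tmul {M : ModuleCat.{u} A} (a : A) (c : trivialModule k H)
    (m : M) : leftUnitorLinearEquiv k H M (a • tmul c m) = a • trivialEquiv k H c • m := by
  have horbits : (leftUnitorLinearEquiv k H M).toLinearMap ∘ₗ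
      (tensorEquiv k (trivialModule k H) M).symm.toLinearMap ∘ₗ
        TensorProduct.map (orbitMap k c) (orbitMap k m) =
      orbitMap k (trivialEquiv k H c • m) ∘ₗ (TensorProduct.lid k A).toLinearMap ∘ₗ
        counit.rTensor A := by
    refine TensorProduct.ext' fun h a => ?_
    change trivialEquiv k H (h • c) • a • m = (counit (R := k) h • a) • trivialEquiv k H c • m
    rw [trivialEquiv_smul, mul_smul, smul_assoc, smul_comm a]
  calc leftUnitorLinearEquiv k H M (a • tmul c m)
      = _ := congrArg _ (LinearMap.congr_fun (orbitMap_tmul c m) a)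
    _ = _ := LinearMap.congr_fun horbits (LeftComoduleAlgebra.coact a)
    _ = orbitMap k (trivialEquiv k H c • m) a :=
      congrArg (orbitMap k (trivialEquiv k H c • m))
        (LeftComoduleAlgebra.counit_coact (k := k) (H := H) a)

variable (k H) in
/-- The isomorphism `k ⊗ M ≅ M`. -/
def leftUnitor (M : ModuleCat.{u} A) : tensorObj k (trivialModule k H) M ≅ M :=
  isoOfTensorLinearEquiv (leftUnitorLinearEquiv k H M) fun a c m => by
    rw [leftUnitorLinearEquiv_smul_tmul, ← one_smul A (tmul c m), leftUnitorLinearEquiv_smul_tmul,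
      one_smul]

variable (k) in
/-- The `k`-linear map underlying the right unitor. -/
def rightUnitorLinearEquiv (V : ModuleCat.{u} H) : tensorObj k V (trivialModule k H) ≃ₗ[k] V :=
  tensorEquiv k V _ ≪≫ₗ (trivialEquiv k H).lTensor V ≪≫ₗ TensorProduct.rid k V

theorem rightUnitorLinearEquiv_smul_tmul {V : ModuleCat.{u} H} (h : H) (v : V)
    (c : trivialModule k H) :
    rightUnitorLinearEquiv k V (h • tmul v c) = h • trivialEquiv k H c • v := by
  have horbits : (rightUnitorLinearEquiv k V).toLinearMap ∘ₗ
      (tensorEquiv k V (trivialModule k H)).symm.toLinearMap ∘ₗ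
        TensorProduct.map (orbitMap k v) (orbitMap k c) =
      orbitMap k (trivialEquiv k H c • v) ∘ₗ (TensorProduct.rid k H).toLinearMap ∘ₗ
        counit.lTensor H := by
    refine TensorProduct.ext' fun a h => ?_
    change trivialEquiv k H (h • c) • a • v = (counit (R := k) h • a) • trivialEquiv k H c • v
    rw [trivialEquiv_smul, mul_smul, smul_assoc, smul_comm a]
  calc rightUnitorLinearEquiv k V (h • tmul v c)
      = _ := congrArg _ (LinearMap.congr_fun (orbitMap_tmul v c) h)
    _ = _ := LinearMap.congr_fun horbits (comul h)
    _ = orbitMap k (trivialEquiv k H c • v) h := by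
      simp [lTensor_counit_comul]

variable (k) in
/-- The isomorphism `V ⊗ k ≅ V`. -/
def rightUnitor (V : ModuleCat.{u} H) : tensorObj k V (trivialModule k H) ≅ V :=
  isoOfTensorLinearEquiv (rightUnitorLinearEquiv k V) fun h v c => by
    rw [rightUnitorLinearEquiv_smul_tmul, ← one_smul H (tmul v c),
      rightUnitorLinearEquiv_smul_tmul, one_smul]

end Unit

/-! ### Shifts and cones -/

section Shift

variable {k : Type u} {H : Type u} {A : Type u} [Field k] [Ring H] [HopfAlgebra k H]
  [Ring A] [Algebra k A] [LeftComoduleAlgebra k H A] {Λ : H} (hΛ : IsLeftIntegral k Λ)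

/-- The map of `H`-modules `k ⟶ H` that sends `1` to the left integral `Λ`. -/
def integralHom : trivialModule k H ⟶ regular H :=
  ModuleCat.ofHom (R := H) (X := trivialModule k H) (Y := regular H)
    { toFun := fun c => trivialEquiv k H c • Λ
      map_add' := fun c d => by rw [map_add, add_smul]
      map_smul' := fun h c => by
        rw [trivialEquiv_smul, RingHom.id_apply, smul_eq_mul, mul_smul_comm, hΛ.mul_eq, smul_smul,
          mul_comm] }

theorem leftUnitor_integralInclusion (M : ModuleCat.{u} A) :
    (leftUnitor k H M).hom ≫ integralInclusion k hΛ M = tensorHom k (integralHom hΛ) (𝟙 M) :=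
  tensor_ext fun c m => by
    change tmul (V := regular H) Λ (trivialEquiv k H c • m) =
      tmul (V := regular H) (trivialEquiv k H c • Λ) m
    rw [← algebraMap_smul A, ← smul_tmul, algebraMap_smul]

/-- The complex `k → H → H / kΛ` of `H`-modules. -/
def integralComplex : ShortComplex (ModuleCat.{u} H) where
  f := integralHom hΛ
  g := regularProj Λ
  zero := by
    ext c
    refine (Submodule.Quotient.mk_eq_zero _).2 ?_
    change trivialEquiv k H c • Λ ∈ _
    rw [Algebra.smul_def]
    exact Submodule.smul_mem _ _ (Submodule.mem_span_singleton_self Λ)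

instance epi_regularProj : Epi (regularProj Λ) :=
  (ModuleCat.epi_iff_surjective _).2 (Submodule.mkQ_surjective _)

instance : Epi (integralComplex hΛ).g := epi_regularProj

theorem integralComplex_exact : (integralComplex hΛ).Exact := by
  rw [ShortComplex.moduleCat_exact_iff]
  intro x hx
  obtain ⟨h, rfl⟩ := Submodule.mem_span_singleton.1 ((Submodule.Quotient.mk_eq_zero _).1 hx)
  exact ⟨(trivialEquiv k H).symm (Coalgebra.counit h), (hΛ.mul_eq h).symm⟩

/-- The complex `M → H ⊗ M → T M`. -/
def shiftComplex (M : ModuleCat.{u} A) : ShortComplex (ModuleCat.{u} A) where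
  f := integralInclusion k hΛ M
  g := shiftProj k Λ M
  zero := integralInclusion_shiftProj k hΛ M

/-- The complex `M → H ⊗ M → T M` is the tensor product of `k → H → H / kΛ` with `M`. -/
def integralComplexTensorIso (M : ModuleCat.{u} A) :
    (integralComplex hΛ).map (tensorRightFunctor k H M) ≅ shiftComplex hΛ M :=
  ShortComplex.isoMk (leftUnitor k H M) (Iso.refl _) (Iso.refl _)
    ((leftUnitor_integralInclusion hΛ M).trans (Category.comp_id _).symm)
    ((Category.id_comp _).trans (Category.comp_id _).symm)

theorem shiftComplex_exact (M : ModuleCat.{u} A) : (shiftComplex hΛ M).Exact :=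
  ShortComplex.exact_of_iso (integralComplexTensorIso hΛ M)
    ((integralComplex_exact hΛ).map_of_epi_of_preservesCokernel _ inferInstance inferInstance)

instance epi_shiftProj (M : ModuleCat.{u} A) : Epi (shiftProj k Λ M) :=
  inferInstanceAs (Epi ((tensorRightFunctor k H M).map (regularProj Λ)))

instance (M : ModuleCat.{u} A) : Epi (shiftComplex hΛ M).g := epi_shiftProj M

instance (V : ModuleCat.{u} H) (M : ModuleCat.{u} A) :
    Epi (tensorHom k (𝟙 V) (shiftProj k Λ M)) :=
  inferInstanceAs (Epi ((tensorFunctor k V).map (shiftProj k Λ M)))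

theorem shiftProj_naturality {M N : ModuleCat.{u} A} (f : M ⟶ N) :
    tensorHom k (𝟙 (regular H)) f ≫ shiftProj k Λ N = shiftProj k Λ M ≫ (shift k A Λ).map f :=
  tensor_ext fun _ _ => rfl

section TensorRegular

variable [FiniteDimensional k H]

/-- The isomorphism `V ⊗ (H ⊗ M) ≅ H ⊗ (V ⊗ M)`. -/
def tensorRegularIso (V : ModuleCat.{u} H) (M : ModuleCat.{u} A) :
    tensorObj k V (tensorObj k (regular H) M) ≅ tensorObj k (regular H) (tensorObj k V M) :=
  (associator k V (regular H) M).symm ≪≫ tensorIso k (swapIso hΛ V) (Iso.refl M) ≪≫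
    associator k (regular H) V M

theorem integralInclusion_tensorRegularIso (V : ModuleCat.{u} H) (M : ModuleCat.{u} A) :
    tensorHom k (𝟙 V) (integralInclusion k hΛ M) ≫ (tensorRegularIso hΛ V M).hom =
      integralInclusion k hΛ (tensorObj k V M) := by
  calc tensorHom k (𝟙 V) (integralInclusion k hΛ M) ≫ (tensorRegularIso hΛ V M).hom
      = tensorHom k (integralInclusionRight k hΛ V ≫ (swapIso hΛ V).hom) (𝟙 M) ≫
          (associator k (regular H) V M).hom := tensor_ext fun _ _ => rfl
    _ = tensorHom k (integralInclusion k hΛ V) (𝟙 M) ≫ (associator k (regular H) V M).hom := by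
        rw [integralInclusionRight_swapIso]
    _ = integralInclusion k hΛ (tensorObj k V M) := tensor_ext fun _ _ => rfl

theorem tensorRegularIso_naturality (V : ModuleCat.{u} H) {M N : ModuleCat.{u} A} (f : M ⟶ N) :
    tensorHom k (𝟙 V) (tensorHom k (𝟙 (regular H)) f) ≫ (tensorRegularIso hΛ V N).hom =
      (tensorRegularIso hΛ V M).hom ≫ tensorHom k (𝟙 (regular H)) (tensorHom k (𝟙 V) f) := by
  rw [← cancel_epi (associator k V (regular H) M).hom, ← reassoc_of% associator_naturality k]
  simp only [tensorRegularIso, Iso.trans_hom, Iso.symm_hom, tensorIso_hom, Iso.refl_hom,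
    Category.assoc, Iso.hom_inv_id_assoc, ← associator_naturality,
    reassoc_of% tensorHom_comp k, tensorHom_id, Category.comp_id, Category.id_comp]

/-- The arrow isomorphism `(V ⊗ M → V ⊗ (H ⊗ M)) ≅ (V ⊗ M → H ⊗ (V ⊗ M))`, whose cokernel is
`shiftTensorIso`. -/
def integralInclusionIso (V : ModuleCat.{u} H) (M : ModuleCat.{u} A) :
    Arrow.mk ((tensorFunctor k V).map (integralInclusion k hΛ M)) ≅
      Arrow.mk (integralInclusion k hΛ (tensorObj k V M)) :=
  Arrow.isoMk (Iso.refl _) (tensorRegularIso hΛ V M)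
    ((Category.id_comp _).trans (integralInclusion_tensorRegularIso hΛ V M).symm)

/-- The isomorphism `V ⊗ T M ≅ T (V ⊗ M)`. -/
def shiftTensorIso (V : ModuleCat.{u} H) (M : ModuleCat.{u} A) :
    tensorObj k V ((shift k A Λ).obj M) ≅ (shift k A Λ).obj (tensorObj k V M) :=
  Limits.CokernelCofork.mapIsoOfIsColimit
    (Limits.CokernelCofork.mapIsColimit _ (shiftComplex_exact hΛ M).gIsCokernel (tensorFunctor k V))
    (shiftComplex_exact hΛ (tensorObj k V M)).gIsCokernel (integralInclusionIso hΛ V M)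

theorem shiftProj_shiftTensorIso (V : ModuleCat.{u} H) (M : ModuleCat.{u} A) :
    tensorHom k (𝟙 V) (shiftProj k Λ M) ≫ (shiftTensorIso hΛ V M).hom =
      (tensorRegularIso hΛ V M).hom ≫ shiftProj k Λ (tensorObj k V M) :=
  Limits.CokernelCofork.π_mapOfIsColimit
    (Limits.CokernelCofork.mapIsColimit _ (shiftComplex_exact hΛ M).gIsCokernel (tensorFunctor k V))
    _ (integralInclusionIso hΛ V M).hom

theorem shiftTensorIso_naturality (V : ModuleCat.{u} H) {M N : ModuleCat.{u} A} (f : M ⟶ N) :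
    tensorHom k (𝟙 V) ((shift k A Λ).map f) ≫ (shiftTensorIso hΛ V N).hom =
      (shiftTensorIso hΛ V M).hom ≫ (shift k A Λ).map (tensorHom k (𝟙 V) f) := by
  have hproj : tensorHom k (𝟙 V) (shiftProj k Λ M) ≫ tensorHom k (𝟙 V) ((shift k A Λ).map f) =
      tensorHom k (𝟙 V) (tensorHom k (𝟙 (regular H)) f) ≫ tensorHom k (𝟙 V) (shiftProj k Λ N) := by
    rw [tensorHom_comp, tensorHom_comp, shiftProj_naturality]
  rw [← cancel_epi (tensorHom k (𝟙 V) (shiftProj k Λ M)), reassoc_of% hproj,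
    shiftProj_shiftTensorIso, reassoc_of% tensorRegularIso_naturality hΛ V f,
    shiftProj_naturality, reassoc_of% shiftProj_shiftTensorIso hΛ V M]

/-- The natural isomorphism `V ⊗ T M ≅ T (V ⊗ M)`. -/
def shiftTensorNatIso (A : Type u) [Ring A] [Algebra k A] [LeftComoduleAlgebra k H A]
    (V : ModuleCat.{u} H) :
    shift k A Λ ⋙ tensorFunctor k V ≅ tensorFunctor k V ⋙ shift k A Λ :=
  NatIso.ofComponents (shiftTensorIso hΛ V) (shiftTensorIso_naturality hΛ V)

end TensorRegular

end Shift

section Cone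

variable {k : Type u} {H : Type u} {A B : Type u} [Field k] [Ring H] [HopfAlgebra k H]
  [Ring A] [Algebra k A] [LeftComoduleAlgebra k H A] [Ring B] [Algebra k B]
  [LeftComoduleAlgebra k H B] {Λ : H} (hΛ : IsLeftIntegral k Λ)

/-- The map `H ⊗ X → C_f`. -/
def coneInr {X Y : ModuleCat.{u} A} (f : X ⟶ Y) : tensorObj k (regular H) X ⟶ cone k hΛ f :=
  Limits.pushout.inr f (integralInclusion k hΛ X)

theorem isPushout_cone {X Y : ModuleCat.{u} A} (f : X ⟶ Y) :
    IsPushout f (integralInclusion k hΛ X) (coneIn k hΛ f) (coneInr hΛ f) :=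
  IsPushout.of_hasPushout f (integralInclusion k hΛ X)

theorem coneIn_coneOut {X Y : ModuleCat.{u} A} (f : X ⟶ Y) :
    coneIn k hΛ f ≫ coneOut k hΛ f = 0 :=
  Limits.pushout.inl_desc _ _ _

theorem coneInr_coneOut {X Y : ModuleCat.{u} A} (f : X ⟶ Y) :
    coneInr hΛ f ≫ coneOut k hΛ f = shiftProj k Λ X :=
  Limits.pushout.inr_desc _ _ _

theorem isPushout_map_cone (F : ModuleCat.{u} A ⥤ ModuleCat.{u} B)
    [Limits.PreservesFiniteColimits F] {X Y : ModuleCat.{u} A} (f : X ⟶ Y)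
    (e : F.obj (tensorObj k (regular H) X) ≅ tensorObj k (regular H) (F.obj X))
    (he : F.map (integralInclusion k hΛ X) ≫ e.hom = integralInclusion k hΛ (F.obj X)) :
    IsPushout (F.map f) (integralInclusion k hΛ (F.obj X)) (F.map (coneIn k hΛ f))
      (e.inv ≫ F.map (coneInr hΛ f)) :=
  ((isPushout_cone hΛ f).map F).of_iso (Iso.refl _) (Iso.refl _)
    e (Iso.refl _) (by simp) (by simp [he]) (by simp) (by simp)

/-- The isomorphism `F C_f ≅ C_{F f}` for a right exact functor `F` that commutes with
`Λ ⊗ id`. -/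
def coneMapIso (F : ModuleCat.{u} A ⥤ ModuleCat.{u} B)
    [Limits.PreservesFiniteColimits F] {X Y : ModuleCat.{u} A} (f : X ⟶ Y)
    (e : F.obj (tensorObj k (regular H) X) ≅ tensorObj k (regular H) (F.obj X))
    (he : F.map (integralInclusion k hΛ X) ≫ e.hom = integralInclusion k hΛ (F.obj X)) :
    F.obj (cone k hΛ f) ≅ cone k hΛ (F.map f) :=
  (isPushout_map_cone hΛ F f e he).isoPushout

end Cone

section TensorCone

variable {k : Type u} {H : Type u} {A : Type u} [Field k] [Ring H] [HopfAlgebra k H]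
  [Ring A] [Algebra k A] [LeftComoduleAlgebra k H A] {Λ : H} (hΛ : IsLeftIntegral k Λ)

/-- The isomorphism `C_f ⊗ M ≅ C_{f ⊗ M}`. -/
def coneTensorIso {V W : ModuleCat.{u} H} (f : V ⟶ W) (M : ModuleCat.{u} A) :
    tensorObj k (cone k hΛ f) M ≅ cone k hΛ (tensorHom k f (𝟙 M)) :=
  coneMapIso hΛ (tensorRightFunctor k H M) f (associator k (regular H) V M)
    (tensor_ext fun _ _ => rfl)

variable [FiniteDimensional k H]

/-- The isomorphism `V ⊗ C_f ≅ C_{V ⊗ f}`. -/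
def tensorConeIso (V : ModuleCat.{u} H) {X Y : ModuleCat.{u} A} (f : X ⟶ Y) :
    tensorObj k V (cone k hΛ f) ≅ cone k hΛ (tensorHom k (𝟙 V) f) :=
  coneMapIso hΛ (tensorFunctor k V) f (tensorRegularIso hΛ V X)
    (integralInclusion_tensorRegularIso hΛ V X)

theorem coneIn_tensorConeIso (V : ModuleCat.{u} H) {X Y : ModuleCat.{u} A} (f : X ⟶ Y) :
    tensorHom k (𝟙 V) (coneIn k hΛ f) ≫ (tensorConeIso hΛ V f).hom =
      coneIn k hΛ (tensorHom k (𝟙 V) f) :=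
  (isPushout_map_cone hΛ (tensorFunctor k V) f (tensorRegularIso hΛ V X)
    (integralInclusion_tensorRegularIso hΛ V X)).inl_isoPushout_hom

theorem coneInr_tensorConeIso (V : ModuleCat.{u} H) {X Y : ModuleCat.{u} A} (f : X ⟶ Y) :
    tensorHom k (𝟙 V) (coneInr hΛ f) ≫ (tensorConeIso hΛ V f).hom =
      (tensorRegularIso hΛ V X).hom ≫ coneInr hΛ (tensorHom k (𝟙 V) f) := by
  rw [← Iso.inv_comp_eq, ← Category.assoc]
  exact (isPushout_map_cone hΛ (tensorFunctor k V) f (tensorRegularIso hΛ V X)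
    (integralInclusion_tensorRegularIso hΛ V X)).inr_isoPushout_hom

theorem coneOut_tensorConeIso (V : ModuleCat.{u} H) {X Y : ModuleCat.{u} A} (f : X ⟶ Y) :
    tensorHom k (𝟙 V) (coneOut k hΛ f) ≫ (shiftTensorIso hΛ V X).hom =
      (tensorConeIso hΛ V f).hom ≫ coneOut k hΛ (tensorHom k (𝟙 V) f) := by
  have hIn : tensorHom k (𝟙 V) (coneIn k hΛ f) ≫ tensorHom k (𝟙 V) (coneOut k hΛ f) = 0 := by
    rw [tensorHom_comp, coneIn_coneOut]
    exact (tensorFunctor k V).map_zero _ _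
  have hInr : tensorHom k (𝟙 V) (coneInr hΛ f) ≫ tensorHom k (𝟙 V) (coneOut k hΛ f) =
      tensorHom k (𝟙 V) (shiftProj k Λ X) := by
    rw [tensorHom_comp, coneInr_coneOut, Category.comp_id]
  apply ((isPushout_cone hΛ f).map (tensorFunctor k V)).hom_ext
  · change tensorHom k (𝟙 V) (coneIn k hΛ f) ≫ _ ≫ _ = tensorHom k (𝟙 V) (coneIn k hΛ f) ≫ _ ≫ _
    rw [reassoc_of% hIn, reassoc_of% coneIn_tensorConeIso hΛ V f, coneIn_coneOut,
      Limits.zero_comp]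
  · change tensorHom k (𝟙 V) (coneInr hΛ f) ≫ _ ≫ _ = tensorHom k (𝟙 V) (coneInr hΛ f) ≫ _ ≫ _
    rw [reassoc_of% hInr, reassoc_of% coneInr_tensorConeIso hΛ V f, coneInr_coneOut,
      shiftProj_shiftTensorIso]

end TensorCone

/-! ### Stable categories and distinguished triangles -/

section StableIso

variable {A : Type u} [Ring A] {S : ObjectProperty (ModuleCat.{u} A)}

/-- `a` has an inverse up to morphisms that factor through a module from `S`; this is the condition
that `a` becomes an isomorphism in the stable category, see `isIso_toStable_iff`. -/
def StableIso (S : ObjectProperty (ModuleCat.{u} A)) {M N : ModuleCat.{u} A} (a : M ⟶ N) : Prop :=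
  ∃ b : N ⟶ M, FactorsThrough S (a ≫ b - 𝟙 M) ∧ FactorsThrough S (b ≫ a - 𝟙 N)

theorem isIso_toStable_iff [Congruence (stableRel S)] {M N : ModuleCat.{u} A} (a : M ⟶ N) :
    IsIso ((toStable S).map a) ↔ StableIso S a := by
  have hmap {X Y : ModuleCat.{u} A} (f g : X ⟶ Y) :
      (toStable S).map f = (toStable S).map g ↔ FactorsThrough S (f - g) :=
    CategoryTheory.Quotient.functor_map_eq_iff _ f g
  constructor
  · rintro ⟨b, hab, hba⟩
    obtain ⟨b, rfl⟩ := (toStable S).map_surjective b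
    rw [← Functor.map_comp, ← CategoryTheory.Functor.map_id, hmap] at hab hba
    exact ⟨b, hab, hba⟩
  · rintro ⟨b, hab, hba⟩
    rw [← hmap, Functor.map_comp, CategoryTheory.Functor.map_id] at hab hba
    exact ⟨(toStable S).map b, hab, hba⟩

theorem StableIso.map {B : Type u} [Ring B] {S' : ObjectProperty (ModuleCat.{u} B)}
    (F : ModuleCat.{u} A ⥤ ModuleCat.{u} B) [F.Additive]
    (hF : ∀ {M N : ModuleCat.{u} A} (f : M ⟶ N), FactorsThrough S f → FactorsThrough S' (F.map f))
    {M N : ModuleCat.{u} A} {a : M ⟶ N} (ha : StableIso S a) : StableIso S' (F.map a) := by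
  obtain ⟨b, hab, hba⟩ := ha
  exact ⟨F.map b, by simpa using hF _ hab, by simpa using hF _ hba⟩

theorem StableIso.comp_iso {M N P : ModuleCat.{u} A} {a : M ⟶ N} (ha : StableIso S a) (e : N ≅ P) :
    StableIso S (a ≫ e.hom) := by
  obtain ⟨b, hab, Q, hQ, g₁, g₂, hba⟩ := ha
  refine ⟨e.inv ≫ b, by simpa using hab, Q, hQ, e.inv ≫ g₁, g₂ ≫ e.hom, ?_⟩
  rw [Category.assoc, reassoc_of% hba]
  simp

end StableIso

section Tensor

variable {k : Type u} {H : Type u} {A : Type u} [Field k] [Ring H] [HopfAlgebra k H]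
  [Ring A] [Algebra k A] [LeftComoduleAlgebra k H A] {Λ : H} (hΛ : IsLeftIntegral k Λ)

theorem stableIso_of_iso {M N : ModuleCat.{u} A} (e : M ≅ N) :
    StableIso (induced k H A) e.hom :=
  (isIso_toStable_iff _).1 inferInstance

theorem factorsThrough_tensorRight {V W : ModuleCat.{u} H} {f : V ⟶ W} (M : ModuleCat.{u} A)
    (hf : FactorsThrough (induced k H H) f) :
    FactorsThrough (induced k H A) (tensorHom k f (𝟙 M)) := by
  obtain ⟨P, ⟨N, ⟨e⟩⟩, g₁, g₂, rfl⟩ := hf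
  refine ⟨tensorObj k P M, ⟨tensorObj k N M, ⟨tensorIso k e (Iso.refl M) ≪≫
    associator k (regular H) N M⟩⟩, tensorHom k g₁ (𝟙 M), tensorHom k g₂ (𝟙 M), ?_⟩
  rw [tensorHom_comp, Category.comp_id]

theorem stableIso_tensorRight {V W : ModuleCat.{u} H} {a : V ⟶ W}
    (ha : StableIso (induced k H H) a) (M : ModuleCat.{u} A) :
    StableIso (induced k H A) (tensorHom k a (𝟙 M)) :=
  ha.map (tensorRightFunctor k H M) fun _ => factorsThrough_tensorRight M

theorem mono_tensorHom_id {V W : ModuleCat.{u} H} (f : V ⟶ W) [Mono f] (M : ModuleCat.{u} A) :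
    Mono (tensorHom k f (𝟙 M)) :=
  (ModuleCat.mono_iff_injective (tensorHom k f (𝟙 M))).2 <|
    Module.Flat.rTensor_preserves_injective_linearMap (M := M) (kLin k f)
      ((ModuleCat.mono_iff_injective f).1 inferInstance)

theorem mono_integralHom : Mono (integralHom hΛ) :=
  (ModuleCat.mono_iff_injective _).2 <|
    (smul_left_injective k hΛ.ne_zero).comp (trivialEquiv k H).injective

theorem mono_integralInclusion (M : ModuleCat.{u} A) : Mono (integralInclusion k hΛ M) := by
  have := mono_integralHom hΛ
  have := mono_tensorHom_id (k := k) (integralHom hΛ) M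
  rw [(Iso.eq_inv_comp (leftUnitor k H M)).2 (leftUnitor_integralInclusion hΛ M)]
  infer_instance

variable [FiniteDimensional k H]

include hΛ

theorem factorsThrough_tensorLeft (V : ModuleCat.{u} H) {M N : ModuleCat.{u} A} {f : M ⟶ N}
    (hf : FactorsThrough (induced k H A) f) :
    FactorsThrough (induced k H A) (tensorHom k (𝟙 V) f) := by
  obtain ⟨P, ⟨X, ⟨e⟩⟩, g₁, g₂, rfl⟩ := hf
  refine ⟨tensorObj k V P, ⟨tensorObj k V X, ⟨tensorIso k (Iso.refl V) e ≪≫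
    tensorRegularIso hΛ V X⟩⟩, tensorHom k (𝟙 V) g₁, tensorHom k (𝟙 V) g₂, ?_⟩
  rw [tensorHom_comp, Category.comp_id]

theorem stableIso_tensorLeft (V : ModuleCat.{u} H) {M N : ModuleCat.{u} A} {a : M ⟶ N}
    (ha : StableIso (induced k H A) a) : StableIso (induced k H A) (tensorHom k (𝟙 V) a) :=
  ha.map (tensorFunctor k V) fun _ => factorsThrough_tensorLeft hΛ V

theorem factorsThrough_injectives_iff {V W : ModuleCat.{u} H} (f : V ⟶ W) :
    FactorsThrough (injectives H) f ↔ FactorsThrough (induced k H H) f := by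
  constructor
  · rintro ⟨Q, hQ, g₁, g₂, rfl⟩
    have : Injective Q := hQ
    have := mono_integralInclusion hΛ Q
    refine ⟨tensorObj k (regular H) Q, ⟨Q, ⟨Iso.refl _⟩⟩, g₁ ≫ integralInclusion k hΛ Q,
      Injective.factorThru (𝟙 Q) (integralInclusion k hΛ Q) ≫ g₂, ?_⟩
    rw [Category.assoc, Injective.comp_factorThru_assoc, Category.id_comp]
  · rintro ⟨P, ⟨N, ⟨e⟩⟩, g₁, g₂, rfl⟩
    exact ⟨P, Injective.of_iso e.symm (injective_tensorObj_regular hΛ N), g₁, g₂, rfl⟩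

theorem tensorDescends (A : Type u) [Ring A] [Algebra k A] [LeftComoduleAlgebra k H A]
    (V : ModuleCat.{u} H) : TensorDescends k A V := by
  intro M N f g h
  refine (CategoryTheory.Quotient.functor_map_eq_iff (stableRel (induced k H A)) _ _).2 ?_
  have htensor := factorsThrough_tensorLeft hΛ V h
  change FactorsThrough _ ((tensorFunctor k V).map (f - g)) at htensor
  rwa [Functor.map_sub] at htensor

theorem stableTensor_additive (V : ModuleCat.{u} H) :
    (stableTensor k (tensorDescends hΛ A V)).Additive where
  map_add {X Y f g} := by
    obtain ⟨f, rfl⟩ := (toStable (induced k H A)).map_surjective f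
    obtain ⟨g, rfl⟩ := (toStable (induced k H A)).map_surjective g
    exact congrArg (toStable (induced k H A)).map ((tensorFunctor k V).map_add (f := f) (g := g))

omit [FiniteDimensional k H] in
omit hΛ in
theorem stableTensor_map_comm {V : ModuleCat.{u} H} (hV : TensorDescends k A V)
    {X Y X' Y' : ModuleCat.{u} A}
    {p : (toStable (induced k H A)).obj X ⟶ (toStable (induced k H A)).obj Y}
    {a : X ⟶ X'} {b : Y ⟶ Y'} {f : X' ⟶ Y'}
    (h : p ≫ (toStable (induced k H A)).map b =
      (toStable (induced k H A)).map a ≫ (toStable (induced k H A)).map f) :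
    ((stableTensor k hV).map p : (toStable (induced k H A)).obj (tensorObj k V X) ⟶
        (toStable (induced k H A)).obj (tensorObj k V Y)) ≫
        (toStable (induced k H A)).map (tensorHom k (𝟙 V) b) =
      (toStable (induced k H A)).map (tensorHom k (𝟙 V) a) ≫
        (toStable (induced k H A)).map (tensorHom k (𝟙 V) f) :=
  ((stableTensor k hV).map_comp _ _).symm.trans
    ((congrArg _ h).trans ((stableTensor k hV).map_comp _ _))

theorem isDistinguished_tensor_of_comm (V : ModuleCat.{u} H) {X Y Z X₀ Y₀ : ModuleCat.{u} A}
    {f : X₀ ⟶ Y₀} {a : X ⟶ X₀} {b : Y ⟶ Y₀} {c : Z ⟶ cone k hΛ f}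
    (ha : StableIso (induced k H A) a) (hb : StableIso (induced k H A) b)
    (hc : StableIso (induced k H A) c)
    {p : (toStable (induced k H A)).obj (tensorObj k V X) ⟶
      (toStable (induced k H A)).obj (tensorObj k V Y)}
    {q : (toStable (induced k H A)).obj (tensorObj k V Y) ⟶
      (toStable (induced k H A)).obj (tensorObj k V Z)}
    {r : (toStable (induced k H A)).obj (tensorObj k V Z) ⟶
      (toStable (induced k H A)).obj (tensorObj k V ((shift k A Λ).obj X))}
    (hp : p ≫ (toStable (induced k H A)).map (tensorHom k (𝟙 V) b) =
      (toStable (induced k H A)).map (tensorHom k (𝟙 V) a) ≫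
        (toStable (induced k H A)).map (tensorHom k (𝟙 V) f))
    (hq : q ≫ (toStable (induced k H A)).map (tensorHom k (𝟙 V) c) =
      (toStable (induced k H A)).map (tensorHom k (𝟙 V) b) ≫
        (toStable (induced k H A)).map (tensorHom k (𝟙 V) (coneIn k hΛ f)))
    (hr : r ≫ (toStable (induced k H A)).map (tensorHom k (𝟙 V) ((shift k A Λ).map a)) =
      (toStable (induced k H A)).map (tensorHom k (𝟙 V) c) ≫
        (toStable (induced k H A)).map (tensorHom k (𝟙 V) (coneOut k hΛ f))) :
    IsDistinguished k hΛ (induced k H A) p q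
      (r ≫ (toStable (induced k H A)).map (shiftTensorIso hΛ V X).hom) := by
  refine ⟨tensorObj k V X₀, tensorObj k V Y₀, tensorHom k (𝟙 V) f, tensorHom k (𝟙 V) a,
    tensorHom k (𝟙 V) b, tensorHom k (𝟙 V) c ≫ (tensorConeIso hΛ V f).hom,
    (isIso_toStable_iff _).2 (stableIso_tensorLeft hΛ V ha),
    (isIso_toStable_iff _).2 (stableIso_tensorLeft hΛ V hb),
    (isIso_toStable_iff _).2 ((stableIso_tensorLeft hΛ V hc).comp_iso _), hp, ?_, ?_⟩
  · rw [Functor.map_comp, reassoc_of% hq, ← coneIn_tensorConeIso, Functor.map_comp]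
  · rw [Category.assoc, ← Functor.map_comp, ← shiftTensorIso_naturality, Functor.map_comp,
      reassoc_of% hr, ← Functor.map_comp, coneOut_tensorConeIso, Functor.map_comp,
      Functor.map_comp, Category.assoc]

theorem IsDistinguished.tensor (V : ModuleCat.{u} H) {X Y Z : ModuleCat.{u} A}
    {p : (toStable (induced k H A)).obj X ⟶ (toStable (induced k H A)).obj Y}
    {q : (toStable (induced k H A)).obj Y ⟶ (toStable (induced k H A)).obj Z}
    {r : (toStable (induced k H A)).obj Z ⟶ (toStable (induced k H A)).obj ((shift k A Λ).obj X)}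
    (h : IsDistinguished k hΛ (induced k H A) p q r) :
    IsDistinguished k hΛ (induced k H A)
      (X := tensorObj k V X) (Y := tensorObj k V Y) (Z := tensorObj k V Z)
      ((stableTensor k (tensorDescends hΛ A V)).map p)
      ((stableTensor k (tensorDescends hΛ A V)).map q)
      ((stableTensor k (tensorDescends hΛ A V)).map r ≫
        (toStable (induced k H A)).map (shiftTensorIso hΛ V X).hom) := by
  obtain ⟨X₀, Y₀, f, a, b, c, ha, hb, hc, hp, hq, hr⟩ := h
  exact isDistinguished_tensor_of_comm hΛ V ((isIso_toStable_iff a).1 ha)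
    ((isIso_toStable_iff b).1 hb) ((isIso_toStable_iff c).1 hc)
    (stableTensor_map_comm _ hp) (stableTensor_map_comm _ hq) (stableTensor_map_comm _ hr)

end Tensor

/-! ### Grothendieck groups -/

section Triangle

variable {k : Type u} {H : Type u} {A : Type u} [Field k] [Ring H] [HopfAlgebra k H]
  [Ring A] [Algebra k A] [LeftComoduleAlgebra k H A] {Λ : H} (hΛ : IsLeftIntegral k Λ)

/-- `X`, `Y`, `Z` are the vertices of a distinguished triangle of `A_H-mod`, see `isTriangle_iff`.
The triangle itself is determined by the standard triangle and the three stable isomorphisms. -/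
def IsTriangle (X Y Z : ModuleCat.{u} A) : Prop :=
  ∃ (X₀ Y₀ : ModuleCat.{u} A) (f : X₀ ⟶ Y₀) (a : X ⟶ X₀) (b : Y ⟶ Y₀) (c : Z ⟶ cone k hΛ f),
    StableIso (induced k H A) a ∧ StableIso (induced k H A) b ∧ StableIso (induced k H A) c

/-- The morphisms that factor through a module from `S` are the ones that factor through a module
`H ⊗ N`. This treats both stable categories at once. -/
def IsNullHomotopyClass (k H : Type u) {A : Type u} [Field k] [Ring H] [HopfAlgebra k H] [Ring A]
    [Algebra k A] [LeftComoduleAlgebra k H A] (S : ObjectProperty (ModuleCat.{u} A)) : Prop :=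
  ∀ ⦃M N : ModuleCat.{u} A⦄ (f : M ⟶ N), FactorsThrough S f ↔ FactorsThrough (induced k H A) f

variable {S : ObjectProperty (ModuleCat.{u} A)} (hS : IsNullHomotopyClass k H S)

include hS in
theorem IsNullHomotopyClass.isIso_iff {M N : ModuleCat.{u} A} (a : M ⟶ N) :
    IsIso ((toStable S).map a) ↔ StableIso (induced k H A) a := by
  have hrel : stableRel S = stableRel (induced k H A) := by
    funext M N f g
    exact propext (hS _)
  have : Congruence (stableRel S) := hrel ▸ inferInstance
  simp only [isIso_toStable_iff, StableIso, hS (_ ≫ _ - _)]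

theorem isTriangle_of_isZero {X Y Z : ModuleCat.{u} A} (hX : Limits.IsZero X) (e : Y ≅ Z) :
    IsTriangle hΛ X Y Z := by
  have hX' : Limits.IsZero (tensorObj k (regular H) X) :=
    (tensorFunctor k (regular H)).map_isZero hX
  have : IsIso (integralInclusion k hΛ X) := ⟨0, hX.eq_of_src _ _, hX'.eq_of_src _ _⟩
  have := (isPushout_cone hΛ (0 : X ⟶ Y)).isIso_inl_of_isIso
  exact ⟨X, Y, 0, 𝟙 X, 𝟙 Y, e.inv ≫ coneIn k hΛ 0, stableIso_of_iso (Iso.refl X),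
    stableIso_of_iso (Iso.refl Y), stableIso_of_iso (e.symm ≪≫ asIso (coneIn k hΛ 0))⟩

theorem IsTriangle.tensorRight {X Y Z : ModuleCat.{u} H} (h : IsTriangle hΛ X Y Z)
    (M : ModuleCat.{u} A) :
    IsTriangle hΛ (tensorObj k X M) (tensorObj k Y M) (tensorObj k Z M) := by
  obtain ⟨X₀, Y₀, f, a, b, c, ha, hb, hc⟩ := h
  exact ⟨_, _, tensorHom k f (𝟙 M), _, _, _, stableIso_tensorRight ha M,
    stableIso_tensorRight hb M, (stableIso_tensorRight hc M).comp_iso (coneTensorIso hΛ f M)⟩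

variable [FiniteDimensional k H]

theorem IsTriangle.tensorLeft (V : ModuleCat.{u} H) {X Y Z : ModuleCat.{u} A}
    (h : IsTriangle hΛ X Y Z) :
    IsTriangle hΛ (tensorObj k V X) (tensorObj k V Y) (tensorObj k V Z) := by
  obtain ⟨X₀, Y₀, f, a, b, c, ha, hb, hc⟩ := h
  exact ⟨_, _, tensorHom k (𝟙 V) f, _, _, _, stableIso_tensorLeft hΛ V ha,
    stableIso_tensorLeft hΛ V hb, (stableIso_tensorLeft hΛ V hc).comp_iso (tensorConeIso hΛ V f)⟩

include hS in
theorem isTriangle_iff {X Y Z : ModuleCat.{u} A} :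
    IsTriangle hΛ X Y Z ↔ ∃ p q r, IsDistinguished k hΛ S (X := X) (Y := Y) (Z := Z) p q r := by
  simp only [IsTriangle, ← hS.isIso_iff, IsDistinguished]
  constructor
  · rintro ⟨X₀, Y₀, f, a, b, c, ha, hb, hc⟩
    have hTa : IsIso ((toStable S).map ((shift k A Λ).map a)) :=
      (hS.isIso_iff _).2 (stableIso_tensorLeft hΛ _ ((hS.isIso_iff a).1 ha))
    let π := toStable S
    exact ⟨π.map a ≫ π.map f ≫ inv (π.map b), π.map b ≫ π.map (coneIn k hΛ f) ≫ inv (π.map c),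
      π.map c ≫ π.map (coneOut k hΛ f) ≫ inv (π.map ((shift k A Λ).map a)),
      X₀, Y₀, f, a, b, c, ha, hb, hc, by simp [π], by simp [π], by simp [π]⟩
  · rintro ⟨p, q, r, X₀, Y₀, f, a, b, c, ha, hb, hc, -⟩
    exact ⟨X₀, Y₀, f, a, b, c, ha, hb, hc⟩

theorem isNullHomotopyClass_injectives (hΛ : IsLeftIntegral k Λ) :
    IsNullHomotopyClass k H (injectives H) :=
  fun _ _ => factorsThrough_injectives_iff hΛ

omit [FiniteDimensional k H] in
variable (k H A) in
theorem isNullHomotopyClass_induced : IsNullHomotopyClass k H (induced k H A) :=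
  fun _ _ _ => Iff.rfl

end Triangle

section Grothendieck

variable {k : Type u} {H : Type u} {A : Type u} [Field k] [Ring H] [HopfAlgebra k H]
  [Ring A] [Algebra k A] [LeftComoduleAlgebra k H A] {Λ : H} {hΛ : IsLeftIntegral k Λ}
  {S P : ObjectProperty (ModuleCat.{u} A)}

@[ext]
theorem GrothendieckGroup.addMonoidHom_ext {G : Type*} [AddCommGroup G]
    {f g : GrothendieckGroup k hΛ S P →+ G}
    (h : ∀ M, f (cls k hΛ S P M) = g (cls k hΛ S P M)) : f = g :=
  QuotientAddGroup.addMonoidHom_ext _ (FreeAbelianGroup.lift_ext _ _ h)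

variable [FiniteDimensional k H]

/-- The map `[M] ↦ φ M` on the Grothendieck group given by a function `φ` that is additive on
triangles. -/
def GrothendieckGroup.lift (hS : IsNullHomotopyClass k H S) {G : Type*} [AddCommGroup G]
    (φ : P.FullSubcategory → G)
    (hφ : ∀ X Y Z, IsTriangle hΛ X.obj Y.obj Z.obj → φ Y = φ X + φ Z) :
    GrothendieckGroup k hΛ S P →+ G :=
  QuotientAddGroup.lift _ (FreeAbelianGroup.lift φ) <| by
    rw [AddSubgroup.closure_le]
    rintro _ ⟨X, Y, Z, p, q, r, h, rfl⟩
    simp [hφ X Y Z ((isTriangle_iff hΛ hS).2 ⟨p, q, r, h⟩)]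

theorem GrothendieckGroup.lift_cls (hS : IsNullHomotopyClass k H S) {G : Type*} [AddCommGroup G]
    (φ : P.FullSubcategory → G) (hφ) (M : P.FullSubcategory) :
    GrothendieckGroup.lift (hΛ := hΛ) hS φ hφ (cls k hΛ S P M) = φ M :=
  FreeAbelianGroup.lift_apply_of φ M

theorem IsTriangle.cls_eq_add (hS : IsNullHomotopyClass k H S) {X Y Z : P.FullSubcategory}
    (h : IsTriangle hΛ X.obj Y.obj Z.obj) :
    cls k hΛ S P Y = cls k hΛ S P X + cls k hΛ S P Z := by
  obtain ⟨p, q, r, h⟩ := (isTriangle_iff hΛ hS).1 h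
  rw [← sub_eq_zero]
  exact (QuotientAddGroup.eq_zero_iff _).2 (AddSubgroup.subset_closure ⟨X, Y, Z, p, q, r, h, rfl⟩)

theorem cls_eq_of_iso (hS : IsNullHomotopyClass k H S) {Z : ModuleCat.{u} A} (hZ : Limits.IsZero Z)
    (hPZ : P Z) {M N : P.FullSubcategory} (e : M.obj ≅ N.obj) :
    cls k hΛ S P M = cls k hΛ S P N := by
  have hM := IsTriangle.cls_eq_add hS (X := ⟨Z, hPZ⟩) (isTriangle_of_isZero hΛ hZ e)
  have hN := IsTriangle.cls_eq_add hS (X := ⟨Z, hPZ⟩)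
    (isTriangle_of_isZero hΛ hZ (Iso.refl N.obj))
  rw [hM, ← hN]

end Grothendieck

section Pairing

variable {k : Type u} {H : Type u} {A : Type u} [Field k] [Ring H] [HopfAlgebra k H]
  [Ring A] [Algebra k A] [LeftComoduleAlgebra k H A] {Λ : H} (hΛ : IsLeftIntegral k Λ)
  {S P : ObjectProperty (ModuleCat.{u} A)}
  (hP : ∀ V M, finDim k H V → P M → P (tensorObj k V M))

theorem finDim_punit : finDim k H (ModuleCat.of H PUnit) :=
  have : Subsingleton (ModuleCat.of H PUnit.{u + 1}) := inferInstanceAs (Subsingleton PUnit)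
  Module.Finite.of_surjective (0 : k →ₗ[k] ModuleCat.of H PUnit.{u + 1})
    (Function.surjective_to_subsingleton _)

include hP in
theorem exists_isZero_prop {M : ModuleCat.{u} A} (hM : P M) :
    ∃ Z : ModuleCat.{u} A, Limits.IsZero Z ∧ P Z :=
  ⟨tensorObj k (ModuleCat.of H PUnit) M,
    (tensorRightFunctor k H M).map_isZero (ModuleCat.isZero_of_subsingleton _),
    hP _ _ finDim_punit hM⟩

variable [FiniteDimensional k H] (hS : IsNullHomotopyClass k H S)

/-- The map `[M] ↦ [V ⊗ M]` of Grothendieck groups, for a finite-dimensional `H`-module `V`. -/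
def clsTensor (V : (finDim k H).FullSubcategory) :
    GrothendieckGroup k hΛ S P →+ GrothendieckGroup k hΛ S P :=
  GrothendieckGroup.lift hS (fun M => cls k hΛ S P ⟨tensorObj k V.obj M.obj, hP _ _ V.2 M.2⟩)
    fun _ _ _ h => (h.tensorLeft hΛ V.obj).cls_eq_add hS

/-- The pairing `([V], [M]) ↦ [V ⊗ M]` of Grothendieck groups. -/
def tensorPairing : KH k hΛ →+ GrothendieckGroup k hΛ S P →+ GrothendieckGroup k hΛ S P :=
  GrothendieckGroup.lift (isNullHomotopyClass_injectives hΛ) (clsTensor hΛ hP hS)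
    fun X Y Z h => by
      ext M
      simp only [clsTensor, GrothendieckGroup.lift_cls, AddMonoidHom.add_apply]
      exact (h.tensorRight hΛ M.obj).cls_eq_add hS

theorem tensorPairing_cls (V : (finDim k H).FullSubcategory) (M : P.FullSubcategory) :
    tensorPairing hΛ hP hS (clsH k hΛ V) (cls k hΛ S P M) =
      cls k hΛ S P ⟨tensorObj k V.obj M.obj, hP _ _ V.2 M.2⟩ := by
  rw [tensorPairing, GrothendieckGroup.lift_cls, clsTensor, GrothendieckGroup.lift_cls]

/-- The product `[V][W] = [V ⊗ W]` on the Grothendieck group of the stable category of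
`H`-modules. -/
def tensorProduct : KH k hΛ →+ KH k hΛ →+ KH k hΛ :=
  tensorPairing hΛ (fun _ _ => finDim_tensorObj k) (isNullHomotopyClass_injectives hΛ)

theorem tensorProduct_cls (V W : (finDim k H).FullSubcategory) :
    tensorProduct hΛ (clsH k hΛ V) (clsH k hΛ W) =
      clsH k hΛ ⟨tensorObj k V.obj W.obj, finDim_tensorObj k V.2 W.2⟩ :=
  tensorPairing_cls hΛ _ _ V W

theorem tensorPairing_tensorProduct (x y : KH k hΛ) (m : GrothendieckGroup k hΛ S P) :
    tensorPairing hΛ hP hS (tensorProduct hΛ x y) m =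
      tensorPairing hΛ hP hS x (tensorPairing hΛ hP hS y m) := by
  let pairing := tensorPairing hΛ hP hS
  have hassoc : (AddMonoidHom.compHom pairing).comp (tensorProduct hΛ) =
      (AddMonoidHom.compHom.flip pairing).comp (AddMonoidHom.compHom.comp pairing) := by
    ext V W M
    obtain ⟨Z, hZ, hPZ⟩ := exists_isZero_prop hP M.2
    change pairing (tensorProduct hΛ (clsH k hΛ V) (clsH k hΛ W)) _ =
      pairing (clsH k hΛ V) (pairing (clsH k hΛ W) _)
    simp only [pairing, tensorProduct_cls, tensorPairing_cls]
    exact cls_eq_of_iso hS hZ hPZ (associator k V.obj W.obj M.obj)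
  exact DFunLike.congr_fun (DFunLike.congr_fun (DFunLike.congr_fun hassoc x) y) m

theorem tensorPairing_trivialModule (m : GrothendieckGroup k hΛ S P) :
    tensorPairing hΛ hP hS (clsH k hΛ ⟨trivialModule k H, finDim_trivialModule k⟩) m = m := by
  suffices tensorPairing hΛ hP hS (clsH k hΛ ⟨trivialModule k H, finDim_trivialModule k⟩) =
    AddMonoidHom.id _ from DFunLike.congr_fun this m
  ext M
  obtain ⟨Z, hZ, hPZ⟩ := exists_isZero_prop hP M.2
  rw [tensorPairing_cls]
  exact cls_eq_of_iso hS hZ hPZ (leftUnitor k H M.obj)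

theorem tensorProduct_trivialModule (x : KH k hΛ) :
    tensorProduct hΛ x (clsH k hΛ ⟨trivialModule k H, finDim_trivialModule k⟩) = x := by
  suffices (tensorProduct hΛ).flip (clsH k hΛ ⟨trivialModule k H, finDim_trivialModule k⟩) =
    AddMonoidHom.id _ from DFunLike.congr_fun this x
  ext V
  exact (tensorProduct_cls hΛ _ _).trans (cls_eq_of_iso (isNullHomotopyClass_injectives hΛ)
    (ModuleCat.isZero_of_subsingleton (ModuleCat.of H PUnit)) finDim_punit (rightUnitor k V.obj))

/-- The ring structure on the Grothendieck group of the stable category of `H`-modules. -/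
abbrev grothendieckRing : Ring (KH k hΛ) :=
  { grothendieckAddCommGroup k hΛ (injectives H) (finDim k H) with
    mul := fun x y => tensorProduct hΛ x y
    one := clsH k hΛ ⟨trivialModule k H, finDim_trivialModule k⟩
    left_distrib := fun x => map_add (tensorProduct hΛ x)
    right_distrib := fun x y => DFunLike.congr_fun (map_add (tensorProduct hΛ) x y)
    zero_mul := DFunLike.congr_fun (map_zero (tensorProduct hΛ))
    mul_zero := fun x => map_zero (tensorProduct hΛ x)
    mul_assoc := tensorPairing_tensorProduct hΛ _ _
    one_mul := tensorPairing_trivialModule hΛ _ _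
    mul_one := tensorProduct_trivialModule hΛ }

/-- The `K(H-mod)`-module structure on the Grothendieck group of a class of `A`-modules that is
closed under tensoring with finite-dimensional `H`-modules. -/
abbrev grothendieckModule :
    @Module (KH k hΛ) (GrothendieckGroup k hΛ S P) (grothendieckRing hΛ).toSemiring
      (grothendieckAddCommGroup k hΛ S P).toAddCommMonoid :=
  letI := grothendieckRing hΛ
  { smul := fun x m => tensorPairing hΛ hP hS x m
    one_smul := tensorPairing_trivialModule hΛ hP hS
    mul_smul := tensorPairing_tensorProduct hΛ hP hS
    smul_zero := fun x => map_zero (tensorPairing hΛ hP hS x)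
    smul_add := fun x => map_add (tensorPairing hΛ hP hS x)
    add_smul := fun x y => DFunLike.congr_fun (map_add (tensorPairing hΛ hP hS) x y)
    zero_smul := DFunLike.congr_fun (map_zero (tensorPairing hΛ hP hS)) }

end Pairing

section Closure

variable {k : Type u} {H : Type u} {A : Type u} [Field k] [Ring H] [HopfAlgebra k H]
  [Ring A] [Algebra k A] [LeftComoduleAlgebra k H A] {P : ObjectProperty (ModuleCat.{u} A)}
  [P.IsClosedUnderQuotients] {M : ModuleCat.{u} A}

theorem prop_tensorObj_of_epi {V W : ModuleCat.{u} H} (f : V ⟶ W) [Epi f]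
    (hV : P (tensorObj k V M)) : P (tensorObj k W M) :=
  have : Epi (tensorHom k f (𝟙 M)) := inferInstanceAs (Epi ((tensorRightFunctor k H M).map f))
  P.prop_of_epi (tensorHom k f (𝟙 M)) hV

theorem prop_tensorObj_biprod
    (hprod : ∀ M N : ModuleCat.{u} A, P M → P N → P (ModuleCat.of A (M × N)))
    {V W : ModuleCat.{u} H} (hV : P (tensorObj k V M)) (hW : P (tensorObj k W M)) :
    P (tensorObj k (V ⊞ W) M) :=
  have := Limits.preservesBinaryBiproducts_of_preservesBinaryCoproducts (tensorRightFunctor k H M)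
  P.prop_of_iso ((ModuleCat.biprodIsoProd _ _).symm ≪≫
    ((tensorRightFunctor k H M).mapBiprod V W).symm) (hprod _ _ hV hW)

theorem prop_tensorObj_of_finite
    (hprod : ∀ M N : ModuleCat.{u} A, P M → P N → P (ModuleCat.of A (M × N)))
    (hreg : P (tensorObj k (regular H) M)) (V : ModuleCat.{u} H) [Module.Finite H V] :
    P (tensorObj k V M) := by
  suffices ∀ N : Submodule H V, N.FG → P (tensorObj k (ModuleCat.of H N) M) from
    prop_tensorObj_of_epi (Submodule.topEquiv (R := H) (M := V)).toModuleIso.hom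
      (this ⊤ Module.Finite.fg_top)
  refine fun N hN => Submodule.fg_induction
    (motive := fun N _ => P (tensorObj k (ModuleCat.of H N) M)) (fun x => ?_)
    (fun N₁ N₂ _ _ h₁ h₂ => ?_) N hN
  · have : Epi (ModuleCat.ofHom (LinearMap.toSpanSingleton H V x).rangeRestrict) :=
      (ModuleCat.epi_iff_surjective _).2 (LinearMap.surjective_rangeRestrict _)
    rw [← LinearMap.range_toSpanSingleton]
    exact prop_tensorObj_of_epi (V := regular H)
      (ModuleCat.ofHom (LinearMap.toSpanSingleton H V x).rangeRestrict) hreg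
  · let i₁ := ModuleCat.ofHom (Submodule.inclusion (le_sup_left : N₁ ≤ N₁ ⊔ N₂))
    let i₂ := ModuleCat.ofHom (Submodule.inclusion (le_sup_right : N₂ ≤ N₁ ⊔ N₂))
    have : Epi (Limits.biprod.desc i₁ i₂) := by
      rw [ModuleCat.epi_iff_surjective]
      rintro ⟨y, hy⟩
      obtain ⟨a, ha, b, hb, rfl⟩ := Submodule.mem_sup.1 hy
      let l : ModuleCat.of H N₁ ⟶ ModuleCat.of H N₁ ⊞ ModuleCat.of H N₂ := Limits.biprod.inl
      let r : ModuleCat.of H N₂ ⟶ ModuleCat.of H N₁ ⊞ ModuleCat.of H N₂ := Limits.biprod.inr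
      refine ⟨l ⟨a, ha⟩ + r ⟨b, hb⟩, ?_⟩
      rw [map_add, ← ConcreteCategory.comp_apply, ← ConcreteCategory.comp_apply,
        Limits.biprod.inl_desc, Limits.biprod.inr_desc]
      rfl
    exact prop_tensorObj_of_epi (Limits.biprod.desc i₁ i₂) (prop_tensorObj_biprod hprod h₁ h₂)

theorem prop_tensorObj_of_finDim
    (hprod : ∀ M N : ModuleCat.{u} A, P M → P N → P (ModuleCat.of A (M × N)))
    (hreg : P (tensorObj k (regular H) M)) {V : ModuleCat.{u} H} (hV : finDim k H V) :
    P (tensorObj k V M) :=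
  have : Module.Finite k V := hV
  have : Module.Finite H V := Module.Finite.of_restrictScalars_finite k H V
  prop_tensorObj_of_finite hprod hreg V

end Closure

end

end Hopfological

theorem mainTheorem9_general (k H A : Type u) [Field k] [Ring H] [HopfAlgebra k H]
    [FiniteDimensional k H] [Ring A] [Algebra k A] [LeftComoduleAlgebra k H A]
    (Λ : H) (hΛ : IsLeftIntegral k Λ) :
    (∃ r : ∀ V : ModuleCat.{u} H, tensorObj k V (regular H) ≅ tensorObj k (regular H) V,
      (∀ (V W : ModuleCat.{u} H) (f : V ⟶ W),
        tensorHom k f (𝟙 (regular H)) ≫ (r W).hom = (r V).hom ≫ tensorHom k (𝟙 (regular H)) f) ∧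
      (∀ V : ModuleCat.{u} H,
        integralInclusionRight k hΛ V ≫ (r V).hom = integralInclusion k hΛ V)) ∧
    (∀ V : ModuleCat.{u} H, ∃ hV : TensorDescends k A V,
      (stableTensor k hV).Additive ∧
      ∃ θ : shift k A Λ ⋙ tensorFunctor k V ≅ tensorFunctor k V ⋙ shift k A Λ,
        ∀ (X Y Z : ModuleCat.{u} A)
          (p : (toStable (induced k H A)).obj X ⟶ (toStable (induced k H A)).obj Y)
          (q : (toStable (induced k H A)).obj Y ⟶ (toStable (induced k H A)).obj Z)
          (r : (toStable (induced k H A)).obj Z ⟶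
            (toStable (induced k H A)).obj ((shift k A Λ).obj X)),
          IsDistinguished k hΛ (induced k H A) p q r →
            IsDistinguished k hΛ (induced k H A)
              (X := tensorObj k V X) (Y := tensorObj k V Y) (Z := tensorObj k V Z)
              ((stableTensor k hV).map p) ((stableTensor k hV).map q)
              ((stableTensor k hV).map r ≫ (toStable (induced k H A)).map (θ.hom.app X))) ∧
    (∃ R : Ring (KH k hΛ),
      R.toAddCommGroup = grothendieckAddCommGroup k hΛ (injectives H) (finDim k H) ∧
      R.one = clsH k hΛ ⟨trivialModule k H, finDim_trivialModule k⟩ ∧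
      (∀ V W : (finDim k H).FullSubcategory,
        R.mul (clsH k hΛ V) (clsH k hΛ W) =
          clsH k hΛ ⟨tensorObj k V.obj W.obj, finDim_tensorObj k V.property W.property⟩) ∧
      ∀ (P : ObjectProperty (ModuleCat.{u} A))
        [P.IsClosedUnderQuotients],
        (∀ M N : ModuleCat.{u} A, P M → P N → P (ModuleCat.of A (M × N))) →
        (∀ M : ModuleCat.{u} A, P M → P (tensorObj k (regular H) M)) →
        ∃ act : @Module (KH k hΛ) (KA k hΛ P) R.toSemiring
            (grothendieckAddCommGroup k hΛ (induced k H A) P).toAddCommMonoid,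
          ∀ (V : (finDim k H).FullSubcategory) (M : P.FullSubcategory),
            ∃ hVM : P (tensorObj k V.obj M.obj),
              act.smul (clsH k hΛ V) (clsA k hΛ P M) =
                clsA k hΛ P ⟨tensorObj k V.obj M.obj, hVM⟩) := by
  refine ⟨⟨swapIso hΛ, fun V W f => swapIso_naturality hΛ f, integralInclusionRight_swapIso hΛ⟩,
    fun V => ⟨tensorDescends hΛ A V, stableTensor_additive hΛ V, shiftTensorNatIso hΛ A V,
      fun X Y Z p q r h => h.tensor hΛ V⟩,
    grothendieckRing hΛ, rfl, rfl, tensorProduct_cls hΛ, fun P _ hprod hreg => ?_⟩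
  have hP (V : ModuleCat.{u} H) (M : ModuleCat.{u} A) (hV : finDim k H V) (hM : P M) :
      P (tensorObj k V M) := prop_tensorObj_of_finDim hprod (hreg M hM) hV
  exact ⟨grothendieckModule hΛ hP (isNullHomotopyClass_induced k H A),
    fun V M => ⟨hP V.obj M.obj V.property M.property, tensorPairing_cls hΛ hP _ V M⟩⟩

theorem mainTheorem9 (k H A : Type u) [Field k] [Ring H] [HopfAlgebra k H] [FiniteDimensional k H]
    [Ring A] [Algebra k A] [LeftComoduleAlgebra k H A]
    (Λ : H) (hΛ : IsLeftIntegral k Λ) :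
    (∃ r : ∀ V : ModuleCat.{u} H, tensorObj k V (regular H) ≅ tensorObj k (regular H) V,
      (∀ (V W : ModuleCat.{u} H) (f : V ⟶ W),
        tensorHom k f (𝟙 (regular H)) ≫ (r W).hom = (r V).hom ≫ tensorHom k (𝟙 (regular H)) f) ∧
      (∀ V : ModuleCat.{u} H,
        integralInclusionRight k hΛ V ≫ (r V).hom = integralInclusion k hΛ V)) ∧
    (∀ V : ModuleCat.{u} H, ∃ hV : TensorDescends k A V,
      (stableTensor k hV).Additive ∧
      ∃ θ : shift k A Λ ⋙ tensorFunctor k V ≅ tensorFunctor k V ⋙ shift k A Λ,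
        ∀ (X Y Z : ModuleCat.{u} A)
          (p : (toStable (induced k H A)).obj X ⟶ (toStable (induced k H A)).obj Y)
          (q : (toStable (induced k H A)).obj Y ⟶ (toStable (induced k H A)).obj Z)
          (r : (toStable (induced k H A)).obj Z ⟶
            (toStable (induced k H A)).obj ((shift k A Λ).obj X)),
          IsDistinguished k hΛ (induced k H A) p q r →
            IsDistinguished k hΛ (induced k H A)
              (X := tensorObj k V X) (Y := tensorObj k V Y) (Z := tensorObj k V Z)
              ((stableTensor k hV).map p) ((stableTensor k hV).map q)
              ((stableTensor k hV).map r ≫ (toStable (induced k H A)).map (θ.hom.app X))) ∧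
    (∃ R : Ring (KH k hΛ),
      R.toAddCommGroup = grothendieckAddCommGroup k hΛ (injectives H) (finDim k H) ∧
      R.one = clsH k hΛ ⟨trivialModule k H, finDim_trivialModule k⟩ ∧
      (∀ V W : (finDim k H).FullSubcategory,
        R.mul (clsH k hΛ V) (clsH k hΛ W) =
          clsH k hΛ ⟨tensorObj k V.obj W.obj, finDim_tensorObj k V.property W.property⟩) ∧
      ∀ (P : ObjectProperty (ModuleCat.{u} A)) [P.IsClosedUnderSubobjects]
        [P.IsClosedUnderQuotients],
        (∀ M N : ModuleCat.{u} A, P M → P N → P (ModuleCat.of A (M × N))) →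
        (∀ M : ModuleCat.{u} A, P M → P (tensorObj k (regular H) M)) →
        ∃ act : @Module (KH k hΛ) (KA k hΛ P) R.toSemiring
            (grothendieckAddCommGroup k hΛ (induced k H A) P).toAddCommMonoid,
          ∀ (V : (finDim k H).FullSubcategory) (M : P.FullSubcategory),
            ∃ hVM : P (tensorObj k V.obj M.obj),
              act.smul (clsH k hΛ V) (clsA k hΛ P M) =
                clsA k hΛ P ⟨tensorObj k V.obj M.obj, hVM⟩) := by
  obtain ⟨hswap, htensor, R, hadd, hone, hmul, hact⟩ := mainTheorem9_general k H A Λ hΛ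
  exact ⟨hswap, htensor, R, hadd, hone, hmul, fun P _ _ => hact P⟩
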